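/- A binary linear code of length $n$ is a linear subspace $C\subseteq\mathbb{F}_2^n$; two binary codes are isomorphic if some bijection of their positions maps one onto the other. A code is full-length if no position is zero in all codewords, $\Delta$-divisible if all codeword weights are divisible by $\Delta$, and indecomposable if it is not isomorphic to a direct sum of two non-zero codes. $m\cdot C$ denotes the $m$-fold repetition of $C$. Let $\mathrm{Sim}_2(k)$ be the simplex code (generator matrix whose columns are all non-zero vectors of $\mathbb{F}_2^k$), $\mathrm{RM}_2(k)$, $k\ge 2$, the first order Reed--Muller code of dimension $k$ (generator matrix whose columns are all vectors of $\mathbb{F}_2^{k-1}$, each extended by an entry $1$), and $\mathrm{PC}_2(k)=\{c\in\mathbb{F}_2^{k+1} : c_1+\dots+c_{k+1}=0\}$ the parity check code. **Theorem.** Let $\Delta$ be a positive integer and let $a$ be the largest integer such that $2^a$ divides $\Delta$. The following codes form a complete and non-redundant list of all isomorphism types of binary indecomposable full-length $\Delta$-divisible codes of dimension $k\ge 1$ that are spanned by codewords of weight $\Delta$: 1. $\frac{\Delta}{2^{k-1}}\cdot\mathrm{Sim}_2(k)$ with $1\le k\le a+1$; 2. $\frac{\Delta}{2^{k-2}}\cdot\mathrm{RM}_2(k)$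 with $3\le k\le a+2$; 3. $\frac{\Delta}{2}\cdot\mathrm{PC}_2(k)$ with $a\ge 1$ and $k\ge 4$. That is, each listed code has these properties and dimension $k$, each code with these properties is isomorphic to a listed one, and no two codes listed under different labels are isomorphic. -/

import Mathlib

/-- A binary linear code whose positions are indexed by `ι`
(a code of length `n` is the case `ι = Fin n`). -/
abbrev BinaryCode (ι : Type*) := Submodule (ZMod 2) (ι → ZMod 2)

namespace BinaryCode

/-- Isomorphism of binary codes: some bijection between the positions maps `C` onto `D`. -/
def Iso {ι κ : Type*} (C : BinaryCode ι) (D : BinaryCode κ) : Prop :=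
  ∃ e : ι ≃ κ, Submodule.map (LinearMap.funLeft (ZMod 2) (ZMod 2) e.symm) C = D

/-- No position is zero in all codewords. -/
def FullLength {ι : Type*} (C : BinaryCode ι) : Prop :=
  ∀ i, ∃ c ∈ C, c i ≠ 0

/-- The Hamming weights of all codewords are divisible by `Δ`. -/
def Divisible {ι : Type*} [Fintype ι] (C : BinaryCode ι) (Δ : ℕ) : Prop :=
  ∀ c ∈ C, Δ ∣ hammingNorm c

/-- The codewords of Hamming weight `Δ` span the code. -/
def SpannedByWeight {ι : Type*} [Fintype ι] (C : BinaryCode ι) (Δ : ℕ) : Prop :=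
  Submodule.span (ZMod 2) {c | c ∈ C ∧ hammingNorm c = Δ} = C

/-- The direct sum `{(c, d) | c ∈ C, d ∈ D}`, on the disjoint union of the positions. -/
def directSum {ι κ : Type*} (C : BinaryCode ι) (D : BinaryCode κ) : BinaryCode (ι ⊕ κ) :=
  Submodule.comap (LinearMap.funLeft (ZMod 2) (ZMod 2) Sum.inl) C ⊓
    Submodule.comap (LinearMap.funLeft (ZMod 2) (ZMod 2) Sum.inr) D

/-- A code is decomposable if it is isomorphic to a direct sum of two non-zero codes. -/
def Decomposable {ι : Type*} (C : BinaryCode ι) : Prop :=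
  ∃ (n₁ n₂ : ℕ) (D₁ : BinaryCode (Fin n₁)) (D₂ : BinaryCode (Fin n₂)),
    D₁ ≠ ⊥ ∧ D₂ ≠ ⊥ ∧ Iso C (directSum D₁ D₂)

/-- A code is indecomposable if it is not decomposable. -/
def Indecomposable {ι : Type*} (C : BinaryCode ι) : Prop :=
  ¬ Decomposable C

/-- The `m`-fold repetition `m · C`: every codeword is written `m` times. -/
def repetition {ι : Type*} (m : ℕ) (C : BinaryCode ι) : BinaryCode (Fin m × ι) :=
  Submodule.map (LinearMap.funLeft (ZMod 2) (ZMod 2) (Prod.snd : Fin m × ι → ι)) C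

/-- The code generated by the rows of the matrix `G`. -/
def ofGenerator {ρ ι : Type*} (G : Matrix ρ ι (ZMod 2)) : BinaryCode ι :=
  Submodule.span (ZMod 2) (Set.range fun r => G r)

/-- The binary simplex code of dimension `k`: the columns of the generator matrix are the
non-zero vectors of `𝔽₂ᵏ`. -/
def simplex (k : ℕ) : BinaryCode {v : Fin k → ZMod 2 // v ≠ 0} :=
  ofGenerator (Matrix.of fun (r : Fin k) v => v.1 r)

/-- The binary first order Reed-Muller code of dimension `k ≥ 2`: the columns of the generator
matrix are all vectors of `𝔽₂ᵏ⁻¹`, each extended by an additional entry `1`. -/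
def reedMuller (k : ℕ) : BinaryCode (Fin (k - 1) → ZMod 2) :=
  ofGenerator (Matrix.of fun (r : Fin (k - 1) ⊕ Unit) v => Sum.elim v (fun _ => 1) r)

/-- The binary parity check code of dimension `k`: the words of length `k + 1` with zero sum. -/
def parityCheck (k : ℕ) : BinaryCode (Fin (k + 1)) where
  carrier := {c | ∑ i, c i = 0}
  zero_mem' := by simp
  add_mem' := by
    intro c d hc hd
    simp only [Set.mem_ofPred_eq] at hc hd ⊢
    simp [Finset.sum_add_distrib, hc, hd]
  smul_mem' := by
    intro s c hc
    simp only [Set.mem_ofPred_eq] at hc ⊢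
    simp [← Finset.mul_sum, hc]

/-- The codes to be classified: indecomposable, full-length, `Δ`-divisible, of dimension at
least `1`, and spanned by codewords of weight `Δ`. -/
structure InClass {ι : Type*} [Fintype ι] (C : BinaryCode ι) (Δ : ℕ) : Prop where
  indecomposable : Indecomposable C
  fullLength : FullLength C
  divisible : Divisible C Δ
  one_le_dim : 1 ≤ Module.finrank (ZMod 2) C
  spanned : SpannedByWeight C Δ

/-- Labels for the entries of the classification list: a family and a dimension. -/
inductive Entry where
  | sim (k : ℕ)
  | rm (k : ℕ)
  | pc (k : ℕ)

namespace Entry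

/-- The dimension parameter of an entry. -/
def dim : Entry → ℕ
  | sim k => k
  | rm k => k
  | pc k => k

/-- The entries that occur in the list, where `2 ^ a` is the largest power of `2` dividing `Δ`. -/
def Listed (a : ℕ) : Entry → Prop
  | sim k => 1 ≤ k ∧ k ≤ a + 1
  | rm k => 3 ≤ k ∧ k ≤ a + 2
  | pc k => 1 ≤ a ∧ 4 ≤ k

/-- The positions of the code attached to an entry. -/
def Pos (Δ : ℕ) : Entry → Type
  | sim k => Fin (Δ / 2 ^ (k - 1)) × {v : Fin k → ZMod 2 // v ≠ 0}
  | rm k => Fin (Δ / 2 ^ (k - 2)) × (Fin (k - 1) → ZMod 2)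
  | pc k => Fin (Δ / 2) × Fin (k + 1)

instance (Δ : ℕ) : (e : Entry) → Fintype (e.Pos Δ)
  | sim k => inferInstanceAs (Fintype (Fin (Δ / 2 ^ (k - 1)) × {v : Fin k → ZMod 2 // v ≠ 0}))
  | rm k => inferInstanceAs (Fintype (Fin (Δ / 2 ^ (k - 2)) × (Fin (k - 1) → ZMod 2)))
  | pc k => inferInstanceAs (Fintype (Fin (Δ / 2) × Fin (k + 1)))

/-- The code attached to an entry. For listed entries all the divisions are exact. -/
def code (Δ : ℕ) : (e : Entry) → BinaryCode (e.Pos Δ)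
  | sim k => repetition (Δ / 2 ^ (k - 1)) (simplex k)
  | rm k => repetition (Δ / 2 ^ (k - 2)) (reedMuller k)
  | pc k => repetition (Δ / 2) (parityCheck k)

end Entry

end BinaryCode

/-!
Words over `𝔽₂` with pointwise operations form a Boolean ring in which the product is the
intersection of supports, and `wt (x + y) + 2 * wt (x * y) = wt x + wt y`. Hence two distinct words
of weight `Δ` of a `Δ`-divisible code are disjoint or meet in exactly `Δ / 2` positions
(`Divisible.hammingNorm_mul`).

Completeness rests on three types of codes that are visible from weights and supports: codes with
the single non-zero weight `Δ` (`OneWeight`), codes with one word of weight `2 * Δ` and all other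
non-zero words of weight `Δ` (`ReedMullerWeights`), and codes spanned by the sums of two out of at
least five disjoint blocks of `Δ / 2` positions (`blockCode`). If a subcode `D` of a `Δ`-divisible
code has one of these types and `c ∉ D` is a word of weight `Δ` that is not disjoint from `D`, then
counting intersections shows that `D + ⟨c⟩` has one of these types again (`HasType.sup_span`): the
first type extends to the first or second, the second to itself or, in dimension three only, to
five blocks, and the third to itself with one more block. So if `D ≤ C` is maximal among the
subcodes of these types and `D ≠ C`, all words of weight `Δ` outside of `D` are disjoint from `D`,
and `C`, being spanned by words of weight `Δ`, splits along the support of `D`. An indecomposable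
`C` therefore has one of the three types (`InClass.hasType`).

The weights of a code determine how often each column occurs in a generator matrix, by Fourier
inversion on `𝔽₂^k` (`card_column_mul_two_pow`). For the first two types this gives the repeated
simplex and Reed-Muller codes, together with the divisibility of `Δ` by the power of two in
question; the third type is a repeated parity check code by construction.

Conversely, in a decomposable code every word of minimum weight lies in one of the summands, so a
code spanned by minimum weight words is indecomposable if any two of these meet each other or a
common third one (`indecomposable_of_span_eq`); this holds for all listed codes. The dimension,
and the comparison of the length with `2 * Δ`, tell the listed codes apart (`Entry.eq_of_iso`).
-/

namespace BinaryCode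

/-! ### Words as elements of a Boolean ring -/

section Words

variable {ι : Type*}

theorem word_add_self (x : ι → ZMod 2) : x + x = 0 :=
  funext fun i => CharTwo.add_self_eq_zero (x i)

theorem word_mul_self (x : ι → ZMod 2) : x * x = x := by
  funext i
  have : ∀ z : ZMod 2, z * z = z := by decide
  exact this (x i)

theorem word_add_eq_zero {x y : ι → ZMod 2} : x + y = 0 ↔ x = y := by
  refine ⟨fun h => ?_, fun h => h ▸ word_add_self x⟩
  have := congrArg (· + y) h
  simpa [add_assoc, word_add_self] using this

theorem word_add_add_cancel (x y : ι → ZMod 2) : x + y + y = x := by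
  rw [add_assoc, word_add_self, add_zero]

theorem word_add_mul_mul (x y : ι → ZMod 2) : (x + y) * (x * y) = 0 := by
  funext i
  have : ∀ a b : ZMod 2, (a + b) * (a * b) = 0 := by decide
  exact this (x i) (y i)

theorem mem_sup_span_singleton {D : BinaryCode ι} {c x : ι → ZMod 2} :
    x ∈ D ⊔ Submodule.span (ZMod 2) {c} ↔ x ∈ D ∨ ∃ d ∈ D, x = d + c := by
  have two : ∀ z : ZMod 2, z = 0 ∨ z = 1 := by decide
  rw [Submodule.mem_sup]
  constructor
  · rintro ⟨d, hd, y, hy, rfl⟩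
    obtain ⟨t, rfl⟩ := Submodule.mem_span_singleton.1 hy
    rcases two t with rfl | rfl
    · exact Or.inl (by simpa using hd)
    · exact Or.inr ⟨d, hd, by simp⟩
  · rintro (h | ⟨d, hd, rfl⟩)
    · exact ⟨x, h, 0, Submodule.zero_mem _, by simp⟩
    · exact ⟨d, hd, c, Submodule.mem_span_singleton_self c, rfl⟩

variable [Fintype ι]

theorem hammingNorm_eq_sum_val (x : ι → ZMod 2) : hammingNorm x = ∑ i, (x i).val := by
  have : ∀ z : ZMod 2, (if z ≠ 0 then 1 else 0) = z.val := by decide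
  simp only [hammingNorm, Finset.card_filter, this]

/-- Inclusion-exclusion for supports; the product of two words is the indicator of the
intersection of their supports. -/
theorem hammingNorm_add_add_two_mul (x y : ι → ZMod 2) :
    hammingNorm (x + y) + 2 * hammingNorm (x * y) = hammingNorm x + hammingNorm y := by
  have : ∀ a b : ZMod 2, (a + b).val + 2 * (a * b).val = a.val + b.val := by decide
  simp only [hammingNorm_eq_sum_val, Finset.mul_sum, ← Finset.sum_add_distrib, Pi.add_apply,
    Pi.mul_apply, this]

theorem hammingNorm_add_of_mul_eq_zero {x y : ι → ZMod 2} (h : x * y = 0) :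
    hammingNorm (x + y) = hammingNorm x + hammingNorm y := by
  have := hammingNorm_add_add_two_mul x y
  simpa [h] using this

theorem hammingNorm_mul_add_mul_compl (x y : ι → ZMod 2) :
    hammingNorm (x * y) + hammingNorm (y + x * y) = hammingNorm y := by
  have h := hammingNorm_add_add_two_mul y (x * y)
  have : y * (x * y) = x * y := by rw [mul_left_comm, word_mul_self]
  rw [this] at h
  omega

theorem hammingNorm_mul_le (x y : ι → ZMod 2) : hammingNorm (x * y) ≤ hammingNorm y := by
  have := hammingNorm_mul_add_mul_compl x y
  omega

theorem mul_eq_of_hammingNorm_le {x y : ι → ZMod 2} (h : hammingNorm y ≤ hammingNorm (x * y)) :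
    x * y = y := by
  have := hammingNorm_mul_add_mul_compl x y
  have h0 : hammingNorm (y + x * y) = 0 := by omega
  exact (word_add_eq_zero.1 (hammingNorm_eq_zero.1 h0)).symm

end Words

/-! ### Decomposability -/

section Decomposability

variable {ι κ : Type*}

theorem mem_map_funLeft_symm {C : BinaryCode ι} (e : ι ≃ κ) {y : κ → ZMod 2} :
    y ∈ Submodule.map (LinearMap.funLeft (ZMod 2) (ZMod 2) e.symm) C ↔ y ∘ e ∈ C := by
  rw [Submodule.mem_map]
  constructor
  · rintro ⟨x, hx, rfl⟩
    convert hx using 1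
    funext i
    simp [LinearMap.funLeft_apply]
  · intro h
    exact ⟨_, h, by funext i; simp [LinearMap.funLeft_apply]⟩

theorem mem_directSum {C : BinaryCode ι} {D : BinaryCode κ} {x : ι ⊕ κ → ZMod 2} :
    x ∈ directSum C D ↔ x ∘ Sum.inl ∈ C ∧ x ∘ Sum.inr ∈ D := Iff.rfl

/-- A code splits as a direct sum along a set of positions, given by its indicator `A`, as soon as
it is closed under restriction to that set. -/
theorem decomposable_of_mul_mem [Fintype ι] {C : BinaryCode ι} (A : ι → ZMod 2)
    (hA : ∀ x ∈ C, A * x ∈ C) (h₁ : ∃ x ∈ C, A * x ≠ 0) (h₂ : ∃ x ∈ C, A * x ≠ x) :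
    Decomposable C := by
  classical
  have two : ∀ z : ZMod 2, z = 0 ∨ z = 1 := by decide
  set e : ι ≃ Fin (Fintype.card {i // A i = 1}) ⊕ Fin (Fintype.card {i // ¬ A i = 1}) :=
    (Equiv.sumCompl fun i => A i = 1).symm.trans
      (Equiv.sumCongr (Fintype.equivFin _) (Fintype.equivFin _)) with he
  have hl : ∀ p, A (e.symm (Sum.inl p)) = 1 := fun p => by
    simpa [he] using ((Fintype.equivFin {i // A i = 1}).symm p).2
  have hr : ∀ p, A (e.symm (Sum.inr p)) = 0 := fun p => by
    have := ((Fintype.equivFin {i // ¬ A i = 1}).symm p).2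
    exact (two _).resolve_right (by simpa [he] using this)
  refine ⟨_, _, C.map (LinearMap.funLeft (ZMod 2) (ZMod 2) (e.symm ∘ Sum.inl)),
    C.map (LinearMap.funLeft (ZMod 2) (ZMod 2) (e.symm ∘ Sum.inr)), ?_, ?_, e, ?_⟩
  · obtain ⟨x, hx, hne⟩ := h₁
    intro h
    apply hne
    have h0 : LinearMap.funLeft (ZMod 2) (ZMod 2) (e.symm ∘ Sum.inl) x = 0 := by
      rw [← Submodule.mem_bot (ZMod 2), ← h]
      exact Submodule.mem_map_of_mem hx
    funext i
    obtain ⟨j, rfl⟩ := e.symm.surjective i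
    rcases j with p | p
    · have := congrFun h0 p
      simp [LinearMap.funLeft_apply] at this
      simp [this]
    · simp [hr]
  · obtain ⟨x, hx, hne⟩ := h₂
    intro h
    apply hne
    have h0 : LinearMap.funLeft (ZMod 2) (ZMod 2) (e.symm ∘ Sum.inr) x = 0 := by
      rw [← Submodule.mem_bot (ZMod 2), ← h]
      exact Submodule.mem_map_of_mem hx
    funext i
    obtain ⟨j, rfl⟩ := e.symm.surjective i
    rcases j with p | p
    · simp [hl]
    · have := congrFun h0 p
      simp [LinearMap.funLeft_apply] at this
      simp [this]
  · ext x
    rw [mem_map_funLeft_symm, mem_directSum]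
    constructor
    · intro h
      exact ⟨⟨_, h, by funext p; simp [LinearMap.funLeft_apply]⟩,
        ⟨_, h, by funext p; simp [LinearMap.funLeft_apply]⟩⟩
    · rintro ⟨⟨y, hy, hyx⟩, ⟨z, hz, hzx⟩⟩
      -- glue the restriction of `y` to the set and that of `z` to its complement
      have : x ∘ e = A * y + (z + A * z) := by
        funext i
        obtain ⟨j, rfl⟩ := e.symm.surjective i
        rcases j with p | p
        · have := congrFun hyx p
          simp only [LinearMap.funLeft_apply, Function.comp_apply] at this
          simp [hl, this, CharTwo.add_self_eq_zero]
        · have := congrFun hzx p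
          simp only [LinearMap.funLeft_apply, Function.comp_apply] at this
          simp [hr, this]
      rw [this]
      exact C.add_mem (hA y hy) (C.add_mem hz (hA z hz))

theorem Decomposable.exists_mul_mem {C : BinaryCode ι} (h : Decomposable C) :
    ∃ A : ι → ZMod 2, (∀ x ∈ C, A * x ∈ C) ∧ (∃ x ∈ C, A * x ≠ 0) ∧ ∃ x ∈ C, A * x ≠ x := by
  obtain ⟨n₁, n₂, D₁, D₂, h₁, h₂, e, he⟩ := h
  have key : ∀ x, x ∈ C ↔ x ∘ e.symm ∈ directSum D₁ D₂ := fun x => by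
    rw [← he, mem_map_funLeft_symm]
    simp [Function.comp_assoc]
  refine ⟨fun i => Sum.elim (fun _ => 1) (fun _ => 0) (e i), fun x hx => ?_, ?_, ?_⟩
  · rw [key, mem_directSum] at hx ⊢
    refine ⟨?_, ?_⟩
    · convert hx.1 using 1
      funext p
      simp
    · convert D₂.zero_mem using 1
      funext p
      simp
  · obtain ⟨d, hd, hne⟩ := Submodule.exists_mem_ne_zero_of_ne_bot h₁
    refine ⟨Sum.elim d 0 ∘ e, ?_, fun h0 => hne ?_⟩
    · rw [key, mem_directSum]
      simp [Function.comp_assoc, hd]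
    · funext p
      simpa using congrFun h0 (e.symm (Sum.inl p))
  · obtain ⟨d, hd, hne⟩ := Submodule.exists_mem_ne_zero_of_ne_bot h₂
    refine ⟨Sum.elim 0 d ∘ e, ?_, fun h0 => hne ?_⟩
    · rw [key, mem_directSum]
      simp [Function.comp_assoc, hd]
    · funext p
      simpa using (congrFun h0 (e.symm (Sum.inr p))).symm

/-- A criterion for indecomposability: in a decomposition every word of minimum weight lies in one
of the two summands, so no word of minimum weight meets two such words from different summands. -/
theorem indecomposable_of_span_eq [Fintype ι] {C : BinaryCode ι} {Δ : ℕ}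
    (G : Set (ι → ZMod 2)) (hG : Submodule.span (ZMod 2) G = C)
    (hmin : ∀ x ∈ C, x ≠ 0 → Δ ≤ hammingNorm x) (hw : ∀ g ∈ G, hammingNorm g = Δ)
    (hconn : ∀ r₁ ∈ G, ∀ r₂ ∈ G, r₁ * r₂ = 0 → ∃ r ∈ G, r * r₁ ≠ 0 ∧ r * r₂ ≠ 0) :
    Indecomposable C := by
  intro hdec
  obtain ⟨A, hA, ⟨x, hx, hx0⟩, ⟨y, hy, hy0⟩⟩ := hdec.exists_mul_mem
  have hGC : ∀ g ∈ G, g ∈ C := fun g hg => hG ▸ Submodule.subset_span hg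
  have split : ∀ g ∈ G, A * g = 0 ∨ A * g = g := by
    intro g hg
    by_contra! h
    have h1 := hmin _ (hA g (hGC g hg)) h.1
    have h2 : g + A * g ≠ 0 := fun h0 => h.2 (word_add_eq_zero.1 h0).symm
    have h3 := hammingNorm_pos_iff.2 h2
    have h4 := hammingNorm_mul_add_mul_compl A g
    have h5 := hw g hg
    omega
  obtain ⟨r₁, hr₁, e₁⟩ : ∃ r ∈ G, A * r ≠ 0 := by
    by_contra! h
    apply hx0
    have : C ≤ LinearMap.ker (LinearMap.mulLeft (ZMod 2) A) := by
      rw [← hG, Submodule.span_le]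
      exact fun g hg => h g hg
    exact this hx
  obtain ⟨r₂, hr₂, e₂⟩ : ∃ r ∈ G, A * r ≠ r := by
    by_contra! h
    apply hy0
    have : C ≤ LinearMap.eqLocus (LinearMap.mulLeft (ZMod 2) A) LinearMap.id := by
      rw [← hG, Submodule.span_le]
      exact fun g hg => h g hg
    exact this hy
  have e₁ := (split r₁ hr₁).resolve_left e₁
  have e₂ := (split r₂ hr₂).resolve_right e₂
  obtain ⟨r, hr, m₁, m₂⟩ := hconn r₁ hr₁ r₂ hr₂ (by
    rw [← e₁, mul_comm A, mul_assoc, e₂, mul_zero])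
  rcases split r hr with h | h
  · exact m₁ (by rw [← e₁, ← mul_assoc, mul_comm r, h, zero_mul])
  · exact m₂ (by rw [← h, mul_comm A, mul_assoc, e₂, mul_zero])

end Decomposability

/-! ### The three types of codes and their weights -/

section Types

variable {ι : Type*} [Fintype ι]

/-- All non-zero codewords have weight `Δ`: the weights of a repeated simplex code. -/
def OneWeight (D : BinaryCode ι) (Δ : ℕ) : Prop :=
  ∀ x ∈ D, x ≠ 0 → hammingNorm x = Δ

/-- The codeword `u` has weight `2 * Δ` and all other non-zero codewords have weight `Δ`: the
weights of a repeated first order Reed-Muller code with all-one word `u`. -/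
structure ReedMullerWeights (D : BinaryCode ι) (Δ : ℕ) (u : ι → ZMod 2) : Prop where
  mem : u ∈ D
  norm_u : hammingNorm u = 2 * Δ
  norm_eq : ∀ x ∈ D, x ≠ 0 → x ≠ u → hammingNorm x = Δ

/-- The words `e j` are the indicators of disjoint blocks of `Δ / 2` positions each. -/
structure BlockFamily {κ : Type*} (e : κ → ι → ZMod 2) (Δ : ℕ) : Prop where
  two_mul_norm : ∀ j, 2 * hammingNorm (e j) = Δ
  mul_eq_zero : ∀ i j, i ≠ j → e i * e j = 0

/-- The code spanned by the sums of two blocks: a repeated parity check code. -/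
def blockCode {κ : Type*} (e : κ → ι → ZMod 2) : BinaryCode ι :=
  Submodule.span (ZMod 2) {x | ∃ i j, x = e i + e j}

/-- The disjunction of the three weight types. The bounds exclude the coincidences of the families
in small dimension. -/
def HasType (D : BinaryCode ι) (Δ : ℕ) : Prop :=
  D.OneWeight Δ ∨
  (3 ≤ Module.finrank (ZMod 2) D ∧ ∃ u, D.ReedMullerWeights Δ u) ∨
  ∃ k, 4 ≤ k ∧ ∃ e : Fin (k + 1) → ι → ZMod 2, BlockFamily e Δ ∧ D = blockCode e

end Types

section Blocks

variable {ι κ : Type*}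

theorem add_mem_blockCode (e : κ → ι → ZMod 2) (i j : κ) : e i + e j ∈ blockCode e :=
  Submodule.subset_span ⟨i, j, rfl⟩

theorem blockCode_le {e : κ → ι → ZMod 2} {P : BinaryCode ι} (i₀ : κ)
    (h : ∀ i, e i + e i₀ ∈ P) : blockCode e ≤ P := by
  rw [blockCode, Submodule.span_le]
  rintro x ⟨i, j, rfl⟩
  have : e i + e j = (e i + e i₀) + (e j + e i₀) := by
    rw [add_add_add_comm, word_add_self, add_zero]
  rw [this]
  exact P.add_mem (h i) (h j)

/-- A word of weight `Δ` containing exactly one block and disjoint from the others adds one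
more block, namely its part outside of that block. -/
theorem BlockFamily.snoc [Fintype ι] {Δ k : ℕ} {e : Fin (k + 1) → ι → ZMod 2}
    (he : BlockFamily e Δ) {c : ι → ZMod 2} (hc : hammingNorm c = Δ) (j : Fin (k + 1))
    (hj : c * e j = e j) (hi : ∀ i, i ≠ j → c * e i = 0) :
    ∃ e' : Fin (k + 1 + 1) → ι → ZMod 2, BlockFamily e' Δ ∧
      blockCode e ⊔ Submodule.span (ZMod 2) {c} = blockCode e' := by
  have hnew : ∀ i, (c + e j) * e i = 0 := by
    intro i
    rw [add_mul]
    by_cases h : i = j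
    · subst h
      rw [hj, word_mul_self, word_add_self]
    · rw [hi i h, he.mul_eq_zero j i (Ne.symm h), add_zero]
  refine ⟨Fin.snoc e (c + e j), ⟨?_, ?_⟩, le_antisymm ?_ ?_⟩
  · intro i
    refine Fin.lastCases ?_ (fun i => ?_) i
    · have h1 := hammingNorm_add_add_two_mul c (e j)
      have h2 := he.two_mul_norm j
      rw [hj] at h1
      rw [Fin.snoc_last]
      omega
    · rw [Fin.snoc_castSucc]
      exact he.two_mul_norm i
  · intro a b
    refine Fin.lastCases ?_ (fun i => ?_) a <;> refine Fin.lastCases ?_ (fun i' => ?_) b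
    · simp
    · intro _
      rw [Fin.snoc_last, Fin.snoc_castSucc]
      exact hnew i'
    · intro _
      rw [Fin.snoc_last, Fin.snoc_castSucc, mul_comm]
      exact hnew i
    · intro h
      rw [Fin.snoc_castSucc, Fin.snoc_castSucc]
      exact he.mul_eq_zero i i' fun h' => h (by rw [h'])
  · refine sup_le (blockCode_le j fun i => ?_) ?_
    · have := add_mem_blockCode (Fin.snoc e (c + e j) : Fin (k + 1 + 1) → ι → ZMod 2)
        i.castSucc j.castSucc
      rwa [Fin.snoc_castSucc, Fin.snoc_castSucc] at this
    · rw [Submodule.span_singleton_le_iff_mem]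
      have := add_mem_blockCode (Fin.snoc e (c + e j) : Fin (k + 1 + 1) → ι → ZMod 2)
        (Fin.last _) j.castSucc
      rwa [Fin.snoc_castSucc, Fin.snoc_last, word_add_add_cancel] at this
  · refine blockCode_le j.castSucc fun i => ?_
    rw [Fin.snoc_castSucc]
    refine Fin.lastCases ?_ (fun i => ?_) i
    · rw [Fin.snoc_last, word_add_add_cancel]
      exact Submodule.mem_sup_right (Submodule.mem_span_singleton_self c)
    · rw [Fin.snoc_castSucc]
      exact Submodule.mem_sup_left (add_mem_blockCode e i j)

theorem BlockFamily.sum_hammingNorm_le [Fintype ι] [Fintype κ] {Δ : ℕ} {e : κ → ι → ZMod 2}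
    (he : BlockFamily e Δ) (c : ι → ZMod 2) : ∑ i, hammingNorm (c * e i) ≤ hammingNorm c := by
  classical
  have key : ∀ s : Finset κ, ∑ i ∈ s, hammingNorm (c * e i) = hammingNorm (c * ∑ i ∈ s, e i) := by
    intro s
    induction s using Finset.induction_on with
    | empty => simp
    | insert a s ha ih =>
      rw [Finset.sum_insert ha, Finset.sum_insert ha, mul_add, ih, hammingNorm_add_of_mul_eq_zero]
      have : e a * ∑ i ∈ s, e i = 0 := by
        rw [Finset.mul_sum]
        exact Finset.sum_eq_zero fun i hi => he.mul_eq_zero a i fun h => ha (h ▸ hi)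
      rw [mul_mul_mul_comm, this, mul_zero]
  rw [key, mul_comm]
  exact hammingNorm_mul_le _ _

end Blocks

/-! ### Adjoining a word of weight `Δ` -/

section Extension

variable {ι : Type*} [Fintype ι] {C D : BinaryCode ι} {Δ : ℕ}

/-- Two words of weight `Δ` of a `Δ`-divisible code are equal, disjoint, or meet in `Δ / 2`
positions. -/
theorem Divisible.hammingNorm_mul (hC : C.Divisible Δ) {x y : ι → ZMod 2} (hx : x ∈ C)
    (hy : y ∈ C) (hxΔ : hammingNorm x = Δ) (hyΔ : hammingNorm y = Δ) (hxy : x ≠ y) :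
    hammingNorm (x * y) = 0 ∨ 2 * hammingNorm (x * y) = Δ := by
  have h := hammingNorm_add_add_two_mul x y
  have hpos : 0 < hammingNorm (x + y) :=
    hammingNorm_pos_iff.2 fun h0 => hxy (word_add_eq_zero.1 h0)
  obtain ⟨q, hq⟩ := hC _ (C.add_mem hx hy)
  rw [hxΔ, hyΔ, hq] at h
  rw [hq] at hpos
  have hΔ : 0 < Δ := Nat.pos_of_mul_pos_right hpos
  have hq0 : 0 < q := Nat.pos_of_mul_pos_left hpos
  have hq2 : q ≤ 2 := by
    by_contra hlt
    have : Δ * 3 ≤ Δ * q := Nat.mul_le_mul_left _ (by omega)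
    omega
  interval_cases q <;> omega

theorem exists_mem_not_mem_span {s : Set (ι → ZMod 2)} [Fintype s]
    (h : s.toFinset.card < Module.finrank (ZMod 2) D) :
    ∃ x ∈ D, x ∉ Submodule.span (ZMod 2) s := by
  by_contra! hle
  have h1 := Submodule.finrank_mono (show D ≤ Submodule.span (ZMod 2) s from hle)
  have h2 := finrank_span_le_card (R := ZMod 2) s
  omega

theorem OneWeight.sup_span (hC : C.Divisible Δ) (hD : D.OneWeight Δ) (hDC : D ≤ C)
    {c : ι → ZMod 2} (hcC : c ∈ C) (hcΔ : hammingNorm c = Δ) (hcD : c ∉ D)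
    (hmeet : ∃ d ∈ D, d * c ≠ 0) : (D ⊔ Submodule.span (ZMod 2) {c}).HasType Δ := by
  have hne : ∀ x ∈ D, x ≠ c := fun x hx h => hcD (h ▸ hx)
  have half : ∀ x ∈ D, x * c ≠ 0 → 2 * hammingNorm (x * c) = Δ := by
    intro x hx h0
    have hx0 : x ≠ 0 := fun h => h0 (by rw [h, zero_mul])
    exact (hC.hammingNorm_mul (hDC hx) hcC (hD x hx hx0) hcΔ (hne x hx)).resolve_left
      (hammingNorm_ne_zero_iff.2 h0)
  have wt : ∀ x ∈ D, x * c ≠ 0 → hammingNorm (x + c) = Δ := by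
    intro x hx h0
    have hx0 : x ≠ 0 := fun h => h0 (by rw [h, zero_mul])
    have h1 := hammingNorm_add_add_two_mul x c
    rw [half x hx h0, hD x hx hx0, hcΔ] at h1
    omega
  obtain ⟨x, hx, hxc⟩ := hmeet
  by_cases hS : ∀ s ∈ D, s * c = 0 → s = 0
  · left
    intro y hy hy0
    rcases mem_sup_span_singleton.1 hy with hy | ⟨d, hd, rfl⟩
    · exact hD y hy hy0
    · by_cases hd0 : d = 0
      · rw [hd0, zero_add, hcΔ]
      · exact wt d hd fun h => hd0 (hS d hd h)
  · push Not at hS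
    obtain ⟨s, hs, hsc, hs0⟩ := hS
    have hx0 : x ≠ 0 := fun h => hxc (by rw [h, zero_mul])
    have hxs : x ≠ s := fun h => hxc (by rw [h, hsc])
    have pair : ∀ y ∈ D, ∀ z ∈ D, y ≠ 0 → z ≠ 0 → y ≠ z → 2 * hammingNorm (y * z) = Δ := by
      intro y hy z hz hy0 hz0 hyz
      have h1 := hammingNorm_add_add_two_mul y z
      rw [hD _ (D.add_mem hy hz) fun h => hyz (word_add_eq_zero.1 h), hD y hy hy0,
        hD z hz hz0] at h1
      omega
    -- `s` is the only non-zero word of `D` disjoint from `c`: two such words and the word `c`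
    -- would cover `5 / 4` of the support of `x`
    have uniq : ∀ t ∈ D, t * c = 0 → t ≠ 0 → t = s := by
      intro t ht htc ht0
      by_contra hts
      have hst0 : s + t ≠ 0 := fun h => hts (word_add_eq_zero.1 h).symm
      have hxt : x ≠ t := fun h => hxc (by rw [h, htc])
      have hxst : x ≠ s + t := fun h => hxc (by rw [h, add_mul, hsc, htc, add_zero])
      have p1 := pair x hx s hs hx0 hs0 hxs
      have p2 := pair x hx t ht hx0 ht0 hxt
      have p3 := pair x hx (s + t) (D.add_mem hs ht) hx0 hst0 hxst
      have p4 := half x hx hxc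
      have q1 := hammingNorm_add_add_two_mul (x * s) (x * t)
      have e1 : x * s * (x * t) = x * (s * t) := by rw [mul_mul_mul_comm, word_mul_self]
      rw [e1, ← mul_add] at q1
      have q2 := hammingNorm_add_add_two_mul (x * (s + t)) (x * (s * t))
      have e2 : x * (s + t) * (x * (s * t)) = 0 := by
        rw [mul_mul_mul_comm, word_add_mul_mul, mul_zero]
      rw [e2, hammingNorm_zero] at q2
      have q3 := hammingNorm_add_add_two_mul (x * c) (x * (s + t) + x * (s * t))
      have e3 : x * c * (x * (s + t) + x * (s * t)) = 0 := by
        have : x * c * (x * (s + t) + x * (s * t)) =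
            x * x * (s * c + t * c + s * (t * c)) := by ring
        rw [this, hsc, htc]
        simp
      have e4 : x * c + (x * (s + t) + x * (s * t)) = (c + (s + t) + s * t) * x := by ring
      rw [e3, e4, hammingNorm_zero] at q3
      have q4 := hammingNorm_mul_le (c + (s + t) + s * t) x
      have q5 := hD x hx hx0
      have q6 := hammingNorm_pos_iff.2 hxc
      omega
    right; left
    refine ⟨?_, s + c, mem_sup_span_singleton.2 (Or.inr ⟨s, hs, rfl⟩), ?_, ?_⟩
    · have hx' : x ∉ Submodule.span (ZMod 2) {s} := by
        intro h
        obtain ⟨t, rfl⟩ := Submodule.mem_span_singleton.1 h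
        apply hxc
        rw [smul_mul_assoc, hsc, smul_zero]
      have l1 : Submodule.span (ZMod 2) {s} < D :=
        lt_of_le_of_ne ((Submodule.span_singleton_le_iff_mem _ _).2 hs) fun h => hx' (h ▸ hx)
      have l2 : D < D ⊔ Submodule.span (ZMod 2) {c} :=
        left_lt_sup.2 fun h => hcD (h (Submodule.mem_span_singleton_self c))
      have l3 := Submodule.finrank_lt_finrank_of_lt l1
      have l4 := Submodule.finrank_lt_finrank_of_lt l2
      rw [finrank_span_singleton hs0] at l3
      omega
    · rw [hammingNorm_add_of_mul_eq_zero hsc, hD s hs hs0, hcΔ, two_mul]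
    · intro y hy hy0 hyu
      rcases mem_sup_span_singleton.1 hy with hy | ⟨d, hd, rfl⟩
      · exact hD y hy hy0
      · by_cases hd0 : d = 0
        · rw [hd0, zero_add, hcΔ]
        · exact wt d hd fun h => hyu (by rw [uniq d hd h hd0])

theorem ReedMullerWeights.mul_eq {u : ι → ZMod 2} (hD : D.ReedMullerWeights Δ u)
    {x : ι → ZMod 2} (hx : x ∈ D) : u * x = x := by
  by_cases hx0 : x = 0
  · rw [hx0, mul_zero]
  by_cases hxu : x = u
  · rw [hxu, word_mul_self]
  have h := hammingNorm_add_add_two_mul u x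
  have h1 := hD.norm_eq x hx hx0 hxu
  rw [hD.norm_eq _ (D.add_mem hD.mem hx) (fun h => hxu (word_add_eq_zero.1 h).symm)
    (fun h => hx0 (by simpa using h)), hD.norm_u] at h
  exact mul_eq_of_hammingNorm_le (by omega)

/-- Four blocks cut out by two words `s`, `t` inside of the word `u`. -/
theorem blockFamily_four {s t u : ι → ZMod 2} (hsu : u * s = s) (htu : u * t = t)
    (hs : hammingNorm s = Δ) (ht : hammingNorm t = Δ) (hst : 2 * hammingNorm (s * t) = Δ)
    (hu : hammingNorm u = 2 * Δ) :
    BlockFamily ![s * t, s + s * t, t + s * t, u + s + t + s * t] Δ := by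
  have hb : ∀ a b w : ZMod 2, w * a = a → w * b = b →
      a * b * (a + a * b) = 0 ∧ a * b * (b + a * b) = 0 ∧ a * b * (w + a + b + a * b) = 0 ∧
      (a + a * b) * (b + a * b) = 0 ∧ (a + a * b) * (w + a + b + a * b) = 0 ∧
      (b + a * b) * (w + a + b + a * b) = 0 := by decide
  have hp := fun i => hb (s i) (t i) (u i) (congrFun hsu i) (congrFun htu i)
  have h1 := hammingNorm_mul_add_mul_compl t s
  have h2 := hammingNorm_mul_add_mul_compl s t
  have h3 := hammingNorm_add_add_two_mul s t
  have h4 := hammingNorm_add_of_mul_eq_zero (x := s + t) (y := s * t) (word_add_mul_mul s t)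
  have h5 := hammingNorm_mul_add_mul_compl (s + t + s * t) u
  have e5 : (s + t + s * t) * u = s + t + s * t := by
    have : (s + t + s * t) * u = u * s + u * t + u * s * t := by ring
    rw [this, hsu, htu]
  rw [e5, ← add_assoc, ← add_assoc] at h5
  rw [mul_comm t s] at h1
  constructor
  · intro j
    fin_cases j <;> simp <;> omega
  · intro i j hij
    fin_cases i <;> fin_cases j <;> first
      | exact absurd rfl hij
      | (funext p
         obtain ⟨a1, a2, a3, a4, a5, a6⟩ := hp p
         first
          | exact a1 | exact a2 | exact a3 | exact a4 | exact a5 | exact a6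
          | exact (mul_comm _ _).trans a1 | exact (mul_comm _ _).trans a2
          | exact (mul_comm _ _).trans a3 | exact (mul_comm _ _).trans a4
          | exact (mul_comm _ _).trans a5 | exact (mul_comm _ _).trans a6)

theorem ReedMullerWeights.sup_span (hC : C.Divisible Δ) {u : ι → ZMod 2}
    (hD : D.ReedMullerWeights Δ u) (hdim : 3 ≤ Module.finrank (ZMod 2) D) (hDC : D ≤ C)
    {c : ι → ZMod 2} (hcC : c ∈ C) (hcΔ : hammingNorm c = Δ) (hcD : c ∉ D)
    (hmeet : ∃ d ∈ D, d * c ≠ 0) : (D ⊔ Submodule.span (ZMod 2) {c}).HasType Δ := by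
  have hne : ∀ x ∈ D, x ≠ c := fun x hx h => hcD (h ▸ hx)
  have dich : ∀ x ∈ D, x ≠ 0 → x ≠ u → hammingNorm (x * c) = 0 ∨ 2 * hammingNorm (x * c) = Δ :=
    fun x hx hx0 hxu =>
      hC.hammingNorm_mul (hDC hx) hcC (hD.norm_eq x hx hx0 hxu) hcΔ (hne x hx)
  -- a word `x` and its complement `u + x` partition the intersection of `u` and `c`
  have compl : ∀ x ∈ D, hammingNorm (x * c) + hammingNorm ((u + x) * c) =
      hammingNorm (u * c) := by
    intro x hx
    have h := hammingNorm_mul_add_mul_compl x (u * c)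
    have e1 : x * (u * c) = x * c := by rw [← mul_assoc, mul_comm x u, hD.mul_eq hx]
    rwa [e1, ← add_mul] at h
  have huc : u * c ≠ 0 := by
    obtain ⟨d, hd, hdc⟩ := hmeet
    intro h
    apply hdc
    rw [← hD.mul_eq hd, mul_comm u d, mul_assoc, h, mul_zero]
  have huc' := hammingNorm_pos_iff.2 huc
  have hadd0 : ∀ x, x ≠ u → u + x ≠ 0 := fun x hxu h => hxu (word_add_eq_zero.1 h).symm
  have haddu : ∀ x, x ≠ 0 → u + x ≠ u := fun x hx0 h => hx0 (by simpa using h)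
  by_cases hcase : hammingNorm (u * c) = Δ
  · right; left
    refine ⟨hdim.trans (Submodule.finrank_mono le_sup_left), u, Submodule.mem_sup_left hD.mem,
      hD.norm_u, ?_⟩
    intro y hy hy0 hyu
    rcases mem_sup_span_singleton.1 hy with hy | ⟨d, hd, rfl⟩
    · exact hD.norm_eq y hy hy0 hyu
    · by_cases hd0 : d = 0
      · rw [hd0, zero_add, hcΔ]
      have h1 := hammingNorm_add_add_two_mul d c
      by_cases hdu : d = u
      · rw [hdu] at h1 ⊢
        rw [hD.norm_u] at h1
        omega
      · have h2 := dich d hd hd0 hdu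
        have h3 := dich (u + d) (D.add_mem hD.mem hd) (hadd0 d hdu) (haddu d hd0)
        have h4 := compl d hd
        have h5 := hD.norm_eq d hd hd0 hdu
        omega
  · -- exactly one of `x` and `u + x` is disjoint from `c`
    have excl : ∀ x ∈ D, x ≠ 0 → x ≠ u → 2 * hammingNorm (u * c) = Δ ∧
        (x * c = 0 ∨ (u + x) * c = 0) := by
      intro x hx hx0 hxu
      have h2 := dich x hx hx0 hxu
      have h3 := dich (u + x) (D.add_mem hD.mem hx) (hadd0 x hxu) (haddu x hx0)
      have h4 := compl x hx
      rw [← hammingNorm_eq_zero (x := x * c), ← hammingNorm_eq_zero (x := (u + x) * c)]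
      omega
    have adjust : ∀ P : BinaryCode ι, u ∈ P → ∀ x ∈ D, x ∉ P → ∃ s ∈ D, s ∉ P ∧ s * c = 0 := by
      intro P hP x hx hxP
      have hx0 : x ≠ 0 := fun h => hxP (h ▸ P.zero_mem)
      have hxu : x ≠ u := fun h => hxP (h ▸ hP)
      rcases (excl x hx hx0 hxu).2 with h | h
      · exact ⟨x, hx, hxP, h⟩
      · exact ⟨u + x, D.add_mem hD.mem hx, fun h' => hxP ((P.add_mem_iff_right hP).1 h'), h⟩
    have memspan : ∀ (S : Set (ι → ZMod 2)) (y : ι → ZMod 2), y ∈ S →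
        y ∈ Submodule.span (ZMod 2) S := fun S y h => Submodule.subset_span h
    classical
    obtain ⟨x, hx, hx'⟩ := exists_mem_not_mem_span (D := D) (s := {u})
      (by rw [Set.toFinset_singleton, Finset.card_singleton]; omega)
    obtain ⟨s, hs, hsP, hsc⟩ := adjust _ (memspan {u} u rfl) x hx hx'
    obtain ⟨y, hy, hy'⟩ := exists_mem_not_mem_span (D := D) (s := {u, s})
      (by
        have : ({u, s} : Set (ι → ZMod 2)).toFinset.card ≤ 2 := by
          rw [Set.toFinset_insert, Set.toFinset_singleton]
          exact Finset.card_le_two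
        omega)
    obtain ⟨t, ht, htP, htc⟩ := adjust _ (memspan {u, s} u (by simp)) y hy hy'
    have hs0 : s ≠ 0 := fun h => hsP (h ▸ Submodule.zero_mem _)
    have hsu : s ≠ u := fun h => hsP (h ▸ memspan {u} u rfl)
    have ht0 : t ≠ 0 := fun h => htP (h ▸ Submodule.zero_mem _)
    have htu : t ≠ u := fun h => htP (h ▸ memspan {u, s} u (by simp))
    have hts : t ≠ s := fun h => htP (h ▸ memspan {u, s} s (by simp))
    have htsu : t ≠ s + u := fun h =>
      htP (h ▸ Submodule.add_mem _ (memspan {u, s} s (by simp)) (memspan {u, s} u (by simp)))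
    have hucΔ := (excl s hs hs0 hsu).1
    have pair : ∀ a ∈ D, ∀ b ∈ D, a ≠ 0 → a ≠ u → b ≠ 0 → b ≠ u → b ≠ a → b ≠ a + u →
        2 * hammingNorm (a * b) = Δ := by
      intro a ha b hb ha0 hau hb0 hbu hba hbau
      have h1 := hammingNorm_add_add_two_mul a b
      rw [hD.norm_eq _ (D.add_mem ha hb) (fun h => hba (word_add_eq_zero.1 h).symm)
        (fun h => hbau (by rw [← h, ← add_assoc, word_add_self, zero_add])),
        hD.norm_eq a ha ha0 hau,
        hD.norm_eq b hb hb0 hbu] at h1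
      omega
    have hst := pair s hs t ht hs0 hsu ht0 htu hts htsu
    have hsΔ := hD.norm_eq s hs hs0 hsu
    have htΔ := hD.norm_eq t ht ht0 htu
    -- the dimension is three: the union of three independent words disjoint from `c` leaves only
    -- `Δ / 4` positions of `u`, where `c` needs `Δ / 2`
    have hDspan : D ≤ Submodule.span (ZMod 2) {u, s, t} := by
      intro z hz
      by_contra hzP
      obtain ⟨r, hr, hrP, hrc⟩ := adjust _ (memspan {u, s, t} u (by simp)) z hz hzP
      have mu : u ∈ Submodule.span (ZMod 2) {u, s, t} := memspan _ u (by simp)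
      have ms : s ∈ Submodule.span (ZMod 2) {u, s, t} := memspan _ s (by simp)
      have mt : t ∈ Submodule.span (ZMod 2) {u, s, t} := memspan _ t (by simp)
      have hr' : ∀ w ∈ Submodule.span (ZMod 2) {u, s, t}, r ≠ w := fun w hw h => hrP (h ▸ hw)
      have p1 := pair s hs r hr hs0 hsu (hr' 0 (Submodule.zero_mem _)) (hr' u mu) (hr' s ms)
        (hr' _ (Submodule.add_mem _ ms mu))
      have p2 := pair t ht r hr ht0 htu (hr' 0 (Submodule.zero_mem _)) (hr' u mu) (hr' t mt)
        (hr' _ (Submodule.add_mem _ mt mu))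
      have p3 := pair (s + t) (D.add_mem hs ht) r hr (fun h => hts (word_add_eq_zero.1 h).symm)
        (fun h => htsu (by rw [← h, ← add_assoc, word_add_self, zero_add]))
        (hr' 0 (Submodule.zero_mem _)) (hr' u mu) (hr' _ (Submodule.add_mem _ ms mt))
        (hr' _ (Submodule.add_mem _ (Submodule.add_mem _ ms mt) mu))
      have hrΔ := hD.norm_eq r hr (hr' 0 (Submodule.zero_mem _)) (hr' u mu)
      have q1 := hammingNorm_add_add_two_mul (s * r) (t * r)
      have e1 : s * r * (t * r) = s * t * r := by rw [mul_mul_mul_comm, word_mul_self]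
      rw [e1, ← add_mul] at q1
      -- the union of `s` and `t`
      have q2 := hammingNorm_add_add_two_mul (s + t) (s * t)
      have e2 := word_add_mul_mul s t
      rw [e2, hammingNorm_zero] at q2
      have q3 := hammingNorm_add_add_two_mul s t
      -- its intersection with `r`
      have q4 := hammingNorm_add_add_two_mul ((s + t) * r) (s * t * r)
      have e4 : (s + t) * r * (s * t * r) = 0 := by rw [mul_mul_mul_comm, e2, zero_mul]
      rw [e4, hammingNorm_zero, ← add_mul] at q4
      have q5 := hammingNorm_mul_add_mul_compl (s + t + s * t) r
      -- the union of `s`, `t` and `r`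
      have q6 := hammingNorm_add_of_mul_eq_zero
        (x := s + t + s * t) (y := r + (s + t + s * t) * r) (by
          rw [mul_add, ← mul_assoc, word_mul_self, word_add_self])
      have q7 := hammingNorm_add_of_mul_eq_zero (x := u * c)
        (y := s + t + s * t + (r + (s + t + s * t) * r)) (by
          have : u * c * (s + t + s * t + (r + (s + t + s * t) * r)) =
              u * (s * c + t * c + s * (t * c) + (r * c + (s + t + s * t) * (r * c))) := by ring
          rw [this, hsc, htc, hrc]
          simp)
      have e7 : u * c + (s + t + s * t + (r + (s + t + s * t) * r)) =
          (c + (s + t + s * t + (r + (s + t + s * t) * r))) * u := by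
        have : (c + (s + t + s * t + (r + (s + t + s * t) * r))) * u =
            u * c + (u * s + u * t + u * s * t + (u * r + (s + t + s * t) * (u * r))) := by ring
        rw [this, hD.mul_eq hs, hD.mul_eq ht, hD.mul_eq hr]
      rw [e7] at q7
      have q8 := hammingNorm_mul_le (c + (s + t + s * t + (r + (s + t + s * t) * r))) u
      have q9 := hD.norm_u
      omega
    have hB := blockFamily_four (hD.mul_eq hs) (hD.mul_eq ht) hsΔ htΔ hst hD.norm_u
    set e : Fin 4 → ι → ZMod 2 := ![s * t, s + s * t, t + s * t, u + s + t + s * t] with he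
    have hs_eq : e 1 + e 0 = s := by simp [he, word_add_add_cancel]
    have ht_eq : e 2 + e 0 = t := by simp [he, word_add_add_cancel]
    have hu_eq : e 3 + e 0 = u + s + t := by simp [he, word_add_add_cancel]
    have hDe : D = blockCode e := by
      refine le_antisymm (hDspan.trans ?_) (blockCode_le 0 fun i => ?_)
      · have m1 : s ∈ blockCode e := hs_eq ▸ add_mem_blockCode e 1 0
        have m2 : t ∈ blockCode e := ht_eq ▸ add_mem_blockCode e 2 0
        have m3 : u + s + t ∈ blockCode e := hu_eq ▸ add_mem_blockCode e 3 0
        rw [Submodule.span_le]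
        rintro w (rfl | rfl | rfl)
        · rw [add_assoc] at m3
          exact ((blockCode e).add_mem_iff_left ((blockCode e).add_mem m1 m2)).1 m3
        · exact m1
        · exact m2
      · fin_cases i
        · exact (word_add_self (e 0)).symm ▸ D.zero_mem
        · exact hs_eq.symm ▸ hs
        · exact ht_eq.symm ▸ ht
        · exact hu_eq.symm ▸ D.add_mem (D.add_mem hD.mem hs) ht
    have c0 : c * e 0 = 0 := by
      have : c * e 0 = s * c * t := by simp only [he, Matrix.cons_val]; ring
      rw [this, hsc, zero_mul]
    have c1 : c * e 1 = 0 := by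
      have : c * e 1 = s * c + s * c * t := by simp only [he, Matrix.cons_val]; ring
      rw [this, hsc, zero_mul, add_zero]
    have c2 : c * e 2 = 0 := by
      have : c * e 2 = t * c + s * (t * c) := by simp only [he, Matrix.cons_val]; ring
      rw [this, htc, mul_zero, add_zero]
    have c3 : c * e 3 = e 3 := by
      apply mul_eq_of_hammingNorm_le
      have : c * e 3 = u * c + (s * c + t * c + s * (t * c)) := by
        simp only [he, Matrix.cons_val]; ring
      rw [hsc, htc, mul_zero, add_zero, add_zero, add_zero] at this
      have h3 := hB.two_mul_norm 3
      rw [this]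
      omega
    obtain ⟨e', he', hspan⟩ := hB.snoc hcΔ 3 c3 (by
      intro i hi
      fin_cases i
      · exact c0
      · exact c1
      · exact c2
      · exact absurd rfl hi)
    right; right
    exact ⟨4, le_rfl, e', he', by rw [hDe, hspan]⟩

theorem BlockFamily.sup_span (hC : C.Divisible Δ) {k : ℕ} (hk : 4 ≤ k)
    {e : Fin (k + 1) → ι → ZMod 2} (he : BlockFamily e Δ) (hDC : blockCode e ≤ C)
    {c : ι → ZMod 2} (hcC : c ∈ C) (hcΔ : hammingNorm c = Δ) (hcD : c ∉ blockCode e)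
    (hmeet : ∃ d ∈ blockCode e, d * c ≠ 0) :
    (blockCode e ⊔ Submodule.span (ZMod 2) {c}).HasType Δ := by
  have dich : ∀ i j, i ≠ j → hammingNorm (c * e i) + hammingNorm (c * e j) = 0 ∨
      2 * (hammingNorm (c * e i) + hammingNorm (c * e j)) = Δ := by
    intro i j hij
    have hm := add_mem_blockCode e i j
    have hw : hammingNorm (e i + e j) = Δ := by
      have h1 := hammingNorm_add_of_mul_eq_zero (he.mul_eq_zero i j hij)
      have h2 := he.two_mul_norm i
      have h3 := he.two_mul_norm j
      omega
    have hs : hammingNorm (c * (e i + e j)) = hammingNorm (c * e i) + hammingNorm (c * e j) := by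
      rw [mul_add, hammingNorm_add_of_mul_eq_zero]
      rw [mul_mul_mul_comm, he.mul_eq_zero i j hij, mul_zero]
    rw [← hs]
    exact hC.hammingNorm_mul hcC (hDC hm) hcΔ hw fun h => hcD (h ▸ hm)
  obtain ⟨i, hi⟩ : ∃ i, c * e i ≠ 0 := by
    by_contra! h
    obtain ⟨d, hd, hdc⟩ := hmeet
    apply hdc
    have : blockCode e ≤ LinearMap.ker (LinearMap.mulLeft (ZMod 2) c) := by
      refine blockCode_le 0 fun i => ?_
      simp [mul_add, h]
    rw [mul_comm]
    exact this hd
  have hipos := hammingNorm_pos_iff.2 hi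
  have hother : ∀ j, j ≠ i → c * e j = 0 := by
    intro j hji
    by_contra hj
    have hjpos := hammingNorm_pos_iff.2 hj
    have hij := dich i j (Ne.symm hji)
    -- `c` meets all blocks in the same number `Δ / 4` of positions, and there are at least five
    have hall : ∀ l, 4 * hammingNorm (c * e l) = Δ := by
      obtain ⟨m, hmi, hmj⟩ : ∃ m, m ≠ i ∧ m ≠ j := by
        have : ({i, j} : Finset (Fin (k + 1))).card < Fintype.card (Fin (k + 1)) := by
          have := Finset.card_le_two (a := i) (b := j)
          rw [Fintype.card_fin]
          omega
        obtain ⟨m, hm⟩ := Finset.exists_mem_notMem_of_card_lt_card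
          (s := {i, j}) (t := Finset.univ) (by simpa using this)
        exact ⟨m, by simpa using hm⟩
      have h1 := dich i m (Ne.symm hmi)
      have h2 := dich j m (Ne.symm hmj)
      intro l
      by_cases hli : l = i
      · subst hli
        omega
      · have h3 := dich i l (Ne.symm hli)
        omega
    have hsum := he.sum_hammingNorm_le c
    have : ∑ l, 4 * hammingNorm (c * e l) = (k + 1) * Δ := by simp [hall]
    rw [← Finset.mul_sum] at this
    have h5 : 5 * Δ ≤ (k + 1) * Δ := Nat.mul_le_mul_right _ (by omega)
    have := hall i
    omega
  have hfull : c * e i = e i := by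
    apply mul_eq_of_hammingNorm_le
    obtain ⟨j, hji⟩ : ∃ j, j ≠ i := by
      have : Nontrivial (Fin (k + 1)) := Fin.nontrivial_iff_two_le.2 (by omega)
      exact exists_ne i
    have h1 := dich i j (Ne.symm hji)
    have h2 := he.two_mul_norm i
    rw [hother j hji, hammingNorm_zero] at h1
    omega
  obtain ⟨e', he', hspan⟩ := he.snoc hcΔ i hfull hother
  exact Or.inr (Or.inr ⟨k + 1, by omega, e', he', hspan⟩)

/-- A code of the three types stays within the three types when a word of weight `Δ` that meets
its support is adjoined. -/
theorem HasType.sup_span (hC : C.Divisible Δ) (hD : D.HasType Δ) (hDC : D ≤ C)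
    {c : ι → ZMod 2} (hcC : c ∈ C) (hcΔ : hammingNorm c = Δ) (hcD : c ∉ D)
    (hmeet : ∃ d ∈ D, d * c ≠ 0) : (D ⊔ Submodule.span (ZMod 2) {c}).HasType Δ := by
  rcases hD with h | ⟨hdim, u, h⟩ | ⟨k, hk, e, he, rfl⟩
  · exact h.sup_span hC hDC hcC hcΔ hcD hmeet
  · exact h.sup_span hC hdim hDC hcC hcΔ hcD hmeet
  · exact he.sup_span hC hk hDC hcC hcΔ hcD hmeet

/-- A maximal subcode of one of the three types is all of `C`: otherwise the words of weight `Δ`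
outside of it are disjoint from it, and `C` splits along its support. -/
theorem InClass.hasType (hC : C.InClass Δ) (hΔ : 0 < Δ) : C.HasType Δ := by
  classical
  have hne : C ≠ ⊥ := by
    rintro rfl
    simpa using hC.one_le_dim
  obtain ⟨r, hrC, hrΔ⟩ : ∃ r ∈ C, hammingNorm r = Δ := by
    by_contra! h
    apply hne
    rw [← hC.spanned, Submodule.span_eq_bot]
    exact fun x hx => absurd hx.2 (h x hx.1)
  have hr0 : r ≠ 0 := fun h => by
    rw [h, hammingNorm_zero] at hrΔ
    omega
  have hr : HasType (Submodule.span (ZMod 2) {r}) Δ := by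
    left
    intro x hx hx0
    have := mem_sup_span_singleton (D := ⊥) (c := r) (x := x)
    rw [bot_sup_eq] at this
    rcases this.1 hx with h | ⟨d, hd, rfl⟩
    · exact absurd ((Submodule.mem_bot _).1 h) hx0
    · rw [(Submodule.mem_bot _).1 hd, zero_add, hrΔ]
  obtain ⟨D, hrD, hDmax⟩ := (Set.toFinite
      {D : BinaryCode ι | D ≤ C ∧ D.HasType Δ}).exists_le_maximal
      (a := Submodule.span (ZMod 2) {r})
      ⟨(Submodule.span_singleton_le_iff_mem _ _).2 hrC, hr⟩
  obtain ⟨hDC, hD⟩ := hDmax.prop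
  by_cases hDeq : D = C
  · exact hDeq ▸ hD
  exfalso
  have hdisj : ∀ c ∈ C, hammingNorm c = Δ → c ∉ D → ∀ d ∈ D, d * c = 0 := by
    intro c hcC hcΔ hcD
    by_contra! hmeet
    have hle := hDmax.le_of_ge (y := D ⊔ Submodule.span (ZMod 2) {c})
      ⟨sup_le hDC ((Submodule.span_singleton_le_iff_mem _ _).2 hcC),
        hD.sup_span hC.divisible hDC hcC hcΔ hcD hmeet⟩ le_sup_left
    exact hcD (hle (Submodule.mem_sup_right (Submodule.mem_span_singleton_self c)))
  apply hC.indecomposable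
  -- the indicator of the support of `D`
  set A : ι → ZMod 2 := fun i => if ∃ d ∈ D, d i ≠ 0 then 1 else 0 with hA
  have hAD : ∀ d ∈ D, A * d = d := by
    intro d hd
    funext i
    by_cases h : ∃ d ∈ D, d i ≠ 0
    · simp [hA, h]
    · simp only [Pi.mul_apply, hA, if_neg h, zero_mul]
      push Not at h
      exact (h d hd).symm
  have hAc : ∀ c ∈ C, hammingNorm c = Δ → c ∉ D → A * c = 0 := by
    intro c hcC hcΔ hcD
    funext i
    by_cases h : ∃ d ∈ D, d i ≠ 0
    · obtain ⟨d, hd, hdi⟩ := h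
      have := congrFun (hdisj c hcC hcΔ hcD d hd) i
      simp only [Pi.mul_apply, Pi.zero_apply, mul_eq_zero, hdi, false_or] at this
      simp [this]
    · simp only [Pi.mul_apply, hA, if_neg h, zero_mul, Pi.zero_apply]
  refine decomposable_of_mul_mem A ?_ ⟨r, hrC, ?_⟩ ?_
  · suffices C ≤ C.comap (LinearMap.mulLeft (ZMod 2) A) from fun x hx => this hx
    conv_lhs => rw [← hC.spanned]
    rw [Submodule.span_le]
    rintro x ⟨hxC, hxΔ⟩
    by_cases hxD : x ∈ D
    · simpa [hAD x hxD] using hxC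
    · simp [hAc x hxC hxΔ hxD]
  · rwa [hAD r (hrD (Submodule.mem_span_singleton_self r))]
  · obtain ⟨c, ⟨hcC, hcΔ⟩, hcD⟩ : ∃ c ∈ {c | c ∈ C ∧ hammingNorm c = Δ}, c ∉ D := by
      by_contra! h
      exact hDeq (le_antisymm hDC (hC.spanned ▸ Submodule.span_le.2 h))
    refine ⟨c, hcC, fun h => hcD ?_⟩
    rw [← h, hAc c hcC hcΔ hcD]
    exact D.zero_mem

end Extension

/-! ### Multiplicities of columns from weights -/

section Characters

/-- The non-trivial additive character of `𝔽₂`, with values `1` and `-1`. -/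
def signChar (z : ZMod 2) : ℤ := 1 - 2 * z.val

theorem signChar_zero : signChar 0 = 1 := rfl

theorem signChar_add (x y : ZMod 2) : signChar (x + y) = signChar x * signChar y := by
  revert x y
  decide

variable {ρ ι : Type*} [Fintype ρ] [DecidableEq ρ]

theorem exists_dotProduct_eq_one {z : ρ → ZMod 2} (hz : z ≠ 0) :
    ∃ w : ρ → ZMod 2, w ⬝ᵥ z = 1 := by
  have two : ∀ z : ZMod 2, z ≠ 0 → z = 1 := by decide
  obtain ⟨r, hr⟩ := Function.ne_iff.1 hz
  exact ⟨Pi.single r 1, by simpa using two _ hr⟩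

/-- Orthogonality of characters. -/
theorem sum_signChar_dotProduct (z : ρ → ZMod 2) :
    ∑ a : ρ → ZMod 2, signChar (a ⬝ᵥ z) = if z = 0 then 2 ^ Fintype.card ρ else 0 := by
  split_ifs with hz
  · simp [hz, signChar_zero, ZMod.card]
  · obtain ⟨w, hw⟩ := exists_dotProduct_eq_one hz
    have h := Equiv.sum_comp (Equiv.addRight w) fun a : ρ → ZMod 2 => signChar (a ⬝ᵥ z)
    have h1 : signChar 1 = -1 := rfl
    simp only [Equiv.coe_addRight, add_dotProduct, hw, signChar_add, h1, mul_neg, mul_one,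
      Finset.sum_neg_distrib] at h
    omega

/-- The number of positions in which the words `b r` have the prescribed entries `w r` is
determined by the weights of the linear combinations of the words `b r` (Fourier inversion). -/
theorem card_column_mul_two_pow [Fintype ι] (b : ρ → ι → ZMod 2) (w : ρ → ZMod 2) :
    (Fintype.card {i // (fun r => b r i) = w} : ℤ) * 2 ^ Fintype.card ρ =
      ∑ a : ρ → ZMod 2, signChar (a ⬝ᵥ w) *
        (Fintype.card ι - 2 * hammingNorm (∑ r, a r • b r)) := by
  have h1 : ∀ x : ι → ZMod 2, (Fintype.card ι - 2 * hammingNorm x : ℤ) = ∑ i, signChar (x i) := by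
    intro x
    simp [hammingNorm_eq_sum_val, signChar, Finset.mul_sum]
  have h2 : ∀ (a : ρ → ZMod 2) i, signChar (a ⬝ᵥ w) * signChar ((∑ r, a r • b r) i) =
      signChar (a ⬝ᵥ (w + fun r => b r i)) := by
    intro a i
    rw [dotProduct_add, signChar_add]
    simp [dotProduct, Finset.sum_apply]
  simp only [h1, Finset.mul_sum, h2]
  rw [Finset.sum_comm]
  simp only [sum_signChar_dotProduct, word_add_eq_zero, Fintype.card_subtype]
  rw [← Finset.sum_filter, Finset.sum_const, nsmul_eq_mul]
  simp only [eq_comm]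

theorem exists_equiv_prod_of_card_fiber {κ : Type*} [Fintype ι] [DecidableEq κ] (g : ι → κ) (m : ℕ)
    (h : ∀ v, Fintype.card {i // g i = v} = m) :
    ∃ e : ι ≃ Fin m × κ, ∀ i, (e i).2 = g i := by
  refine ⟨(Equiv.sigmaFiberEquiv g).symm.trans
    ((Equiv.sigmaCongrRight fun v => Fintype.equivFinOfCardEq (h v)).trans
      ((Equiv.sigmaEquivProd κ (Fin m)).trans (Equiv.prodComm κ (Fin m)))), fun i => ?_⟩
  rfl

/-- A code whose generators `b r` take the values of the columns of `G`, each column `m` times,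
is the `m`-fold repetition of the code generated by `G`. -/
theorem iso_repetition_ofGenerator {ρ κ : Type*} [Fintype ι] [DecidableEq κ]
    {b : ρ → ι → ZMod 2} {G : Matrix ρ κ (ZMod 2)} {m : ℕ} (g : ι → κ)
    (hg : ∀ r i, b r i = G r (g i)) (hm : ∀ v, Fintype.card {i // g i = v} = m) :
    Iso (Submodule.span (ZMod 2) (Set.range b)) (repetition m (ofGenerator G)) := by
  obtain ⟨e, he⟩ := exists_equiv_prod_of_card_fiber g m hm
  refine ⟨e, ?_⟩
  rw [repetition, ofGenerator, Submodule.map_span, Submodule.map_span, ← Set.range_comp,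
    ← Set.range_comp]
  congr 2
  funext r p
  simp only [Function.comp_apply, LinearMap.funLeft_apply]
  rw [hg, ← he, Equiv.apply_symm_apply]

end Characters

/-! ### From weights to isomorphism types -/

section Identification

variable {ι : Type*} {C : BinaryCode ι} {Δ k : ℕ}

theorem column_ne_zero {ρ : Type*} (hfull : C.FullLength) {b : ρ → ι → ZMod 2}
    (hb : Submodule.span (ZMod 2) (Set.range b) = C) (i : ι) : (fun r => b r i) ≠ 0 := by
  intro h
  obtain ⟨c, hc, hci⟩ := hfull i
  apply hci
  have : C ≤ LinearMap.ker (LinearMap.proj i : (ι → ZMod 2) →ₗ[ZMod 2] ZMod 2) := by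
    rw [← hb, Submodule.span_le]
    rintro _ ⟨r, rfl⟩
    exact congrFun h r
  exact this hc

theorem sum_smul_ne_zero {ρ : Type*} [Fintype ρ] {b : ρ → ι → ZMod 2}
    (hli : LinearIndependent (ZMod 2) b) {a : ρ → ZMod 2} (ha : a ≠ 0) :
    ∑ r, a r • b r ≠ 0 :=
  fun h => ha (funext (Fintype.linearIndependent_iff.1 hli a h))

theorem sum_smul_mem {ρ : Type*} [Fintype ρ] {b : ρ → ι → ZMod 2}
    (hb : Submodule.span (ZMod 2) (Set.range b) = C) (a : ρ → ZMod 2) : ∑ r, a r • b r ∈ C :=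
  C.sum_mem fun r _ => C.smul_mem _ (hb ▸ Submodule.subset_span ⟨r, rfl⟩)

theorem span_coe_basis {ρ : Type*} (bb : Module.Basis ρ (ZMod 2) C) :
    Submodule.span (ZMod 2) (Set.range fun r => (bb r : ι → ZMod 2)) = C := by
  have := congrArg (Submodule.map C.subtype) bb.span_eq
  rwa [Submodule.map_span, ← Set.range_comp, Submodule.map_subtype_top] at this

theorem linearIndependent_coe_basis {ρ : Type*} (bb : Module.Basis ρ (ZMod 2) C) :
    LinearIndependent (ZMod 2) fun r => (bb r : ι → ZMod 2) :=
  bb.linearIndependent.map' C.subtype C.ker_subtype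

variable [Fintype ι]

/-- A full-length code with a single non-zero weight is a repeated simplex code. -/
theorem OneWeight.iso_simplex (hC : C.OneWeight Δ) (hfull : C.FullLength)
    (hk : Module.finrank (ZMod 2) C = k) (hk1 : 1 ≤ k) :
    2 ^ (k - 1) ∣ Δ ∧ Iso C (repetition (Δ / 2 ^ (k - 1)) (simplex k)) := by
  classical
  set bb := Module.finBasisOfFinrankEq (ZMod 2) C hk
  set b : Fin k → ι → ZMod 2 := fun r => (bb r : ι → ZMod 2)
  have hspan : Submodule.span (ZMod 2) (Set.range b) = C := span_coe_basis bb
  have hli : LinearIndependent (ZMod 2) b := linearIndependent_coe_basis bb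
  have hwt : ∀ a : Fin k → ZMod 2, (hammingNorm (∑ r, a r • b r) : ℤ) =
      Δ - if a = 0 then (Δ : ℤ) else 0 := by
    intro a
    split_ifs with ha
    · simp [ha]
    · rw [hC _ (sum_smul_mem hspan a) (sum_smul_ne_zero hli ha), sub_zero]
  obtain ⟨l, rfl⟩ : ∃ l, k = l + 1 := ⟨k - 1, by omega⟩
  have hcount : ∀ w : Fin (l + 1) → ZMod 2, w ≠ 0 →
      Fintype.card {i // (fun r => b r i) = w} * 2 ^ l = Δ := by
    intro w hw
    have h := card_column_mul_two_pow b w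
    have e : ∀ a : Fin (l + 1) → ZMod 2, signChar (a ⬝ᵥ w) *
        (Fintype.card ι - 2 * hammingNorm (∑ r, a r • b r)) =
        signChar (a ⬝ᵥ w) * (Fintype.card ι - 2 * Δ) +
          if a = 0 then signChar (a ⬝ᵥ w) * (2 * Δ) else 0 := by
      intro a
      rw [hwt]
      split_ifs <;> ring
    simp only [e, Finset.sum_add_distrib, ← Finset.sum_mul, sum_signChar_dotProduct, if_neg hw,
      Finset.sum_ite_eq', Finset.mem_univ, if_true, zero_dotProduct, signChar_zero,
      Fintype.card_fin, pow_succ] at h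
    have : (Fintype.card {i // (fun r => b r i) = w} * 2 ^ l : ℤ) = Δ := by linarith
    exact_mod_cast this
  have hdvd : 2 ^ l ∣ Δ := ⟨_, (hcount (fun _ => 1) fun h => by
    simpa using congrFun h 0).symm.trans (mul_comm _ _)⟩
  refine ⟨hdvd, ?_⟩
  have := iso_repetition_ofGenerator (b := b) (m := Δ / 2 ^ l)
    (G := Matrix.of fun (r : Fin (l + 1)) (v : {v : Fin (l + 1) → ZMod 2 // v ≠ 0}) => v.1 r)
    (fun i => ⟨fun r => b r i, column_ne_zero hfull hspan i⟩) (fun r i => rfl) (by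
      rintro ⟨w, hw⟩
      simp only [Subtype.mk.injEq]
      rw [← hcount w hw, Nat.mul_div_cancel _ (by positivity)])
  rwa [hspan] at this

theorem exists_basis_inr_eq {u : ι → ZMod 2} (hu : u ∈ C) (hu0 : u ≠ 0)
    (hk : Module.finrank (ZMod 2) C = k + 1) :
    ∃ bb : Module.Basis (Fin k ⊕ Unit) (ZMod 2) C, (bb (Sum.inr ()) : ι → ZMod 2) = u := by
  have hu0' : (⟨u, hu⟩ : C) ≠ 0 := fun h => hu0 (congrArg Subtype.val h)
  obtain ⟨W, hW⟩ := Submodule.exists_isCompl (Submodule.span (ZMod 2) {(⟨u, hu⟩ : C)})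
  have h1 := Submodule.finrank_add_eq_of_isCompl hW
  rw [finrank_span_singleton hu0'] at h1
  refine ⟨(Module.Basis.prod (Module.finBasisOfFinrankEq (ZMod 2) W (by omega))
    ((Module.Basis.singleton Unit (ZMod 2)).map
      (LinearEquiv.toSpanNonzeroSingleton (ZMod 2) C ⟨u, hu⟩ hu0'))).map
      (Submodule.prodEquivOfIsCompl _ _ hW.symm), ?_⟩
  simp [Module.Basis.prod_apply]

/-- A full-length code with the weights of a repeated first order Reed-Muller code is such a
code. -/
theorem ReedMullerWeights.iso_reedMuller {u : ι → ZMod 2} (hC : C.ReedMullerWeights Δ u)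
    (hΔ : 0 < Δ) (hfull : C.FullLength) (hk : Module.finrank (ZMod 2) C = k) (hk2 : 2 ≤ k) :
    2 ^ (k - 2) ∣ Δ ∧ Iso C (repetition (Δ / 2 ^ (k - 2)) (reedMuller k)) := by
  classical
  obtain ⟨l, rfl⟩ : ∃ l, k = l + 2 := ⟨k - 2, by omega⟩
  have hu0 : u ≠ 0 := fun h => by
    have := hC.norm_u
    rw [h, hammingNorm_zero] at this
    omega
  obtain ⟨bb, hbu⟩ := exists_basis_inr_eq hC.mem hu0 hk
  set b : Fin (l + 1) ⊕ Unit → ι → ZMod 2 := fun r => (bb r : ι → ZMod 2) with hb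
  have hspan : Submodule.span (ZMod 2) (Set.range b) = C := span_coe_basis bb
  have hli : LinearIndependent (ZMod 2) b := linearIndependent_coe_basis bb
  -- the coordinates of `u`
  set u₀ : Fin (l + 1) ⊕ Unit → ZMod 2 := Pi.single (Sum.inr ()) 1 with hu₀
  have hu₀0 : u₀ ≠ 0 := fun h => by simpa [hu₀] using congrFun h (Sum.inr ())
  have hsum_u : ∑ r, u₀ r • b r = u := by
    rw [Finset.sum_eq_single (Sum.inr ())]
    · simp [hu₀, hb, hbu]
    · intro r _ hr
      simp [hu₀, Pi.single_eq_of_ne hr]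
    · simp
  have hwt : ∀ a : Fin (l + 1) ⊕ Unit → ZMod 2, (hammingNorm (∑ r, a r • b r) : ℤ) =
      Δ - (if a = 0 then (Δ : ℤ) else 0) + if a = u₀ then (Δ : ℤ) else 0 := by
    intro a
    by_cases ha : a = 0
    · simp [ha, hu₀0.symm]
    by_cases hau : a = u₀
    · rw [hau, hsum_u, hC.norm_u, if_neg hu₀0, if_pos rfl]
      push_cast
      ring
    · have hne : ∑ r, a r • b r ≠ u := by
        intro h
        have h2 : ∑ r, (a + u₀) r • b r = 0 := by
          simp only [Pi.add_apply, add_smul, Finset.sum_add_distrib]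
          rw [h, hsum_u, word_add_self]
        exact sum_smul_ne_zero hli (fun h3 => hau (word_add_eq_zero.1 h3)) h2
      rw [hC.norm_eq _ (sum_smul_mem hspan a) (sum_smul_ne_zero hli ha) hne, if_neg ha, if_neg hau]
      ring
  have hcount : ∀ w : Fin (l + 1) ⊕ Unit → ZMod 2, w ≠ 0 →
      (Fintype.card {i // (fun r => b r i) = w} : ℤ) * 2 ^ (l + 1) =
        Δ - signChar (w (Sum.inr ())) * Δ := by
    intro w hw
    have h := card_column_mul_two_pow b w
    have e : ∀ a : Fin (l + 1) ⊕ Unit → ZMod 2, signChar (a ⬝ᵥ w) *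
        (Fintype.card ι - 2 * hammingNorm (∑ r, a r • b r)) =
        signChar (a ⬝ᵥ w) * (Fintype.card ι - 2 * Δ) +
          (if a = 0 then signChar (a ⬝ᵥ w) * (2 * Δ) else 0) -
          if a = u₀ then signChar (a ⬝ᵥ w) * (2 * Δ) else 0 := by
      intro a
      rw [hwt]
      split_ifs <;> ring
    have huw : u₀ ⬝ᵥ w = w (Sum.inr ()) := by simp [hu₀]
    simp only [e, Finset.sum_sub_distrib, Finset.sum_add_distrib, ← Finset.sum_mul,
      sum_signChar_dotProduct, if_neg hw,
      Finset.sum_ite_eq', Finset.mem_univ, if_true, zero_dotProduct, signChar_zero, huw,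
      Fintype.card_sum, Fintype.card_fin, Fintype.card_unit, pow_succ] at h
    rw [pow_succ]
    linarith
  have hone : ∀ i, b (Sum.inr ()) i = 1 := by
    intro i
    by_contra h
    have h0 : b (Sum.inr ()) i = 0 := by
      have two : ∀ z : ZMod 2, z ≠ 1 → z = 0 := by decide
      exact two _ h
    have h1 := hcount (fun r => b r i) (column_ne_zero hfull hspan i)
    rw [h0, signChar_zero, one_mul, sub_self, mul_eq_zero] at h1
    rcases h1 with h1 | h1
    · have : Fintype.card {j // (fun r => b r j) = fun r => b r i} = 0 := by exact_mod_cast h1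
      exact (Fintype.card_eq_zero_iff.1 this).false ⟨i, rfl⟩
    · exact absurd h1 (by positivity)
  have hcount' : ∀ v : Fin (l + 1) → ZMod 2,
      Fintype.card {i // (fun r => b (Sum.inl r) i) = v} * 2 ^ l = Δ := by
    intro v
    have h := hcount (Sum.elim v fun _ => 1) fun h => by simpa using congrFun h (Sum.inr ())
    have e : Fintype.card {i // (fun r => b (Sum.inl r) i) = v} =
        Fintype.card {i // (fun r => b r i) = Sum.elim v fun _ => 1} := by
      refine Fintype.card_congr (Equiv.subtypeEquivRight fun i => ⟨fun h => ?_, fun h => ?_⟩)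
      · funext r
        rcases r with r | r
        · exact congrFun h r
        · exact hone i
      · funext r
        exact congrFun h (Sum.inl r)
    have h1 : signChar 1 = -1 := rfl
    rw [← e, Sum.elim_inr, h1, pow_succ] at h
    have : (Fintype.card {i // (fun r => b (Sum.inl r) i) = v} * 2 ^ l : ℤ) = Δ := by linarith
    exact_mod_cast this
  refine ⟨⟨_, (hcount' 0).symm.trans (mul_comm _ _)⟩, ?_⟩
  have := iso_repetition_ofGenerator (b := b) (m := Δ / 2 ^ l)
    (G := Matrix.of fun (r : Fin (l + 1) ⊕ Unit) (v : Fin (l + 1) → ZMod 2) =>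
      Sum.elim v (fun _ => 1) r)
    (fun i r => b (Sum.inl r) i) (by
      rintro (r | r) i
      · rfl
      · exact hone i) (by
      intro v
      rw [← hcount' v, Nat.mul_div_cancel _ (by positivity)])
  rw [hspan] at this
  exact this

/-- The parity check code is generated by the words with two ones, one of them in position `0`. -/
theorem parityCheck_eq_ofGenerator (k : ℕ) :
    parityCheck k = ofGenerator (Matrix.of fun i : Fin (k + 1) =>
      (Pi.single i 1 + Pi.single 0 1 : Fin (k + 1) → ZMod 2)) := by
  apply le_antisymm
  · intro x hx
    have hx : ∑ i, x i = 0 := hx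
    have : x = ∑ i, x i • (Pi.single i 1 + Pi.single 0 1 : Fin (k + 1) → ZMod 2) := by
      funext j
      simp [Finset.sum_apply, Finset.sum_add_distrib, hx, Pi.single_apply]
    rw [this]
    exact Submodule.sum_mem _ fun i _ => Submodule.smul_mem _ _ (Submodule.subset_span ⟨i, rfl⟩)
  · rw [ofGenerator, Submodule.span_le]
    rintro _ ⟨i, rfl⟩
    change ∑ j, (Pi.single i 1 + Pi.single 0 1 : Fin (k + 1) → ZMod 2) j = 0
    simp [Finset.sum_add_distrib, CharTwo.add_self_eq_zero]

/-- A full-length code spanned by the sums of two blocks is a repeated parity check code. -/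
theorem BlockFamily.iso_parityCheck {e : Fin (k + 1) → ι → ZMod 2} (he : BlockFamily e Δ)
    (hfull : (blockCode e).FullLength) :
    2 ∣ Δ ∧ Iso (blockCode e) (repetition (Δ / 2) (parityCheck k)) := by
  classical
  refine ⟨⟨_, (he.two_mul_norm 0).symm⟩, ?_⟩
  have two : ∀ z : ZMod 2, z ≠ 0 → z = 1 := by decide
  have hspan : Submodule.span (ZMod 2) (Set.range fun i => e i + e 0) = blockCode e := by
    apply le_antisymm
    · rw [Submodule.span_le]
      rintro _ ⟨i, rfl⟩
      exact add_mem_blockCode e i 0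
    · exact blockCode_le 0 fun i => Submodule.subset_span ⟨i, rfl⟩
  -- every position lies in some block
  have hex : ∀ i, ∃ j, e j i ≠ 0 := by
    intro i
    by_contra! h
    exact column_ne_zero hfull hspan i (funext fun j => by simp [h])
  choose g hg using hex
  have hval : ∀ j i, e j i = if g i = j then 1 else 0 := by
    intro j i
    split_ifs with h
    · exact two _ (h ▸ hg i)
    · have := congrFun (he.mul_eq_zero _ _ h) i
      simpa [hg i] using this
  have := iso_repetition_ofGenerator (b := fun i => e i + e 0) (m := Δ / 2)
    (G := Matrix.of fun i : Fin (k + 1) =>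
      (Pi.single i 1 + Pi.single 0 1 : Fin (k + 1) → ZMod 2)) g (by
      intro j i
      simp [hval, Pi.single_apply]) (by
      intro j
      have h1 := he.two_mul_norm j
      have h2 : hammingNorm (e j) = Fintype.card {i // g i = j} := by
        rw [Fintype.card_subtype, hammingNorm]
        congr 1
        ext i
        simp [hval]
      omega)
  rwa [hspan, ← parityCheck_eq_ofGenerator] at this

end Identification

/-! ### The listed codes -/

section Connected

variable {ι : Type*} [Fintype ι] {C : BinaryCode ι} {G : Set (ι → ZMod 2)} {w : ℕ}

/-- The code `C` is `w`-divisible and spanned by the set `G` of words of weight `w`, any two of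
which meet each other or meet a common third one. -/
structure ConnectedBy (C : BinaryCode ι) (G : Set (ι → ZMod 2)) (w : ℕ) : Prop where
  span_eq : Submodule.span (ZMod 2) G = C
  norm_eq : ∀ g ∈ G, hammingNorm g = w
  divisible : C.Divisible w
  exists_meet : ∀ r₁ ∈ G, ∀ r₂ ∈ G, r₁ * r₂ = 0 → ∃ r ∈ G, r * r₁ ≠ 0 ∧ r * r₂ ≠ 0

theorem ConnectedBy.inClass (h : C.ConnectedBy G w) (hfull : C.FullLength)
    (hdim : 1 ≤ Module.finrank (ZMod 2) C) : C.InClass w where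
  indecomposable := indecomposable_of_span_eq G h.span_eq
    (fun x hx hx0 => Nat.le_of_dvd (hammingNorm_pos_iff.2 hx0) (h.divisible x hx)) h.norm_eq
    h.exists_meet
  fullLength := hfull
  divisible := h.divisible
  one_le_dim := hdim
  spanned := by
    apply le_antisymm
    · rw [Submodule.span_le]
      exact fun x hx => hx.1
    · conv_lhs => rw [← h.span_eq]
      exact Submodule.span_mono fun g hg => ⟨h.span_eq ▸ Submodule.subset_span hg, h.norm_eq g hg⟩

theorem OneWeight.connectedBy (h : C.OneWeight w) : C.ConnectedBy {x | x ∈ C ∧ x ≠ 0} w where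
  span_eq := by
    apply le_antisymm
    · rw [Submodule.span_le]
      exact fun x hx => hx.1
    · intro x hx
      by_cases hx0 : x = 0
      · rw [hx0]
        exact Submodule.zero_mem _
      · exact Submodule.subset_span ⟨hx, hx0⟩
  norm_eq := fun g hg => h g hg.1 hg.2
  divisible := by
    intro x hx
    by_cases hx0 : x = 0
    · simp [hx0]
    · rw [h x hx hx0]
  exists_meet := by
    rintro x ⟨hx, hx0⟩ y ⟨hy, hy0⟩ hxy
    refine ⟨x + y, ⟨C.add_mem hx hy, fun h0 => ?_⟩, ?_, ?_⟩
    · rw [word_add_eq_zero.1 h0, word_mul_self] at hxy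
      exact hy0 hxy
    · rwa [add_mul, mul_comm y, hxy, add_zero, word_mul_self]
    · rwa [add_mul, hxy, zero_add, word_mul_self]

theorem ReedMullerWeights.connectedBy {u : ι → ZMod 2} (h : C.ReedMullerWeights w u) (hw : 0 < w)
    (hdim : 3 ≤ Module.finrank (ZMod 2) C) :
    C.ConnectedBy {x | x ∈ C ∧ hammingNorm x = w} w where
  span_eq := by
    classical
    apply le_antisymm
    · rw [Submodule.span_le]
      exact fun x hx => hx.1
    · have key : ∀ x ∈ C, x ≠ u →
          x ∈ Submodule.span (ZMod 2) {x | x ∈ C ∧ hammingNorm x = w} := by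
        intro x hx hxu
        by_cases hx0 : x = 0
        · exact hx0 ▸ Submodule.zero_mem _
        · exact Submodule.subset_span ⟨hx, h.norm_eq x hx hx0 hxu⟩
      intro x hx
      by_cases hxu : x = u
      · obtain ⟨y, hy, hyu⟩ := exists_mem_not_mem_span (D := C) (s := {u})
          (by rw [Set.toFinset_singleton, Finset.card_singleton]; omega)
        have hy0 : y ≠ 0 := fun h0 => hyu (h0 ▸ Submodule.zero_mem _)
        have hyu' : y ≠ u := fun h0 => hyu (by
          rw [h0]
          exact Submodule.mem_span_singleton_self u)
        rw [hxu, ← word_add_add_cancel u y]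
        exact Submodule.add_mem _ (key _ (C.add_mem h.mem hy) fun h0 => hy0 (by simpa using h0))
          (key y hy hyu')
      · exact key x hx hxu
  norm_eq := fun g hg => hg.2
  divisible := by
    intro x hx
    by_cases hx0 : x = 0
    · simp [hx0]
    by_cases hxu : x = u
    · rw [hxu, h.norm_u]
      exact Dvd.intro_left 2 rfl
    · rw [h.norm_eq x hx hx0 hxu]
  exists_meet := by
    classical
    -- two disjoint words of weight `w` are complementary
    have compl : ∀ x y, x ∈ C → y ∈ C → hammingNorm x = w → hammingNorm y = w → x * y = 0 →
        x + y = u := by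
      intro x y hx hy hxw hyw hxy
      have h1 := hammingNorm_add_of_mul_eq_zero hxy
      by_contra hu
      have h0 : x + y ≠ 0 := fun h0 => by
        rw [h0, hammingNorm_zero] at h1
        omega
      have h2 := h.norm_eq _ (C.add_mem hx hy) h0 hu
      omega
    rintro x ⟨hx, hxw⟩ y ⟨hy, hyw⟩ hxy
    obtain ⟨r, hr, hrP⟩ := exists_mem_not_mem_span (D := C) (s := {x, y})
      (by
        have : ({x, y} : Set (ι → ZMod 2)).toFinset.card ≤ 2 := by
          rw [Set.toFinset_insert, Set.toFinset_singleton]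
          exact Finset.card_le_two
        omega)
    have hu := compl x y hx hy hxw hyw hxy
    have mx : x ∈ Submodule.span (ZMod 2) {x, y} := Submodule.subset_span (by simp)
    have my : y ∈ Submodule.span (ZMod 2) {x, y} := Submodule.subset_span (by simp)
    have hrne : ∀ z ∈ Submodule.span (ZMod 2) {x, y}, r ≠ z := fun z hz h0 => hrP (h0 ▸ hz)
    have hrw := h.norm_eq r hr (hrne 0 (Submodule.zero_mem _))
      (hu ▸ hrne _ (Submodule.add_mem _ mx my))
    refine ⟨r, ⟨hr, hrw⟩, fun h0 => ?_, fun h0 => ?_⟩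
    · have := compl r x hr hx hrw hxw h0
      rw [← hu, add_comm x y] at this
      exact hrne y my (add_right_cancel this)
    · have := compl r y hr hy hrw hyw h0
      rw [← hu] at this
      exact hrne x mx (add_right_cancel this)

theorem hammingNorm_comp_snd (m : ℕ) (x : ι → ZMod 2) :
    hammingNorm (x ∘ (Prod.snd : Fin m × ι → ι)) = m * hammingNorm x := by
  simp [hammingNorm_eq_sum_val, Fintype.sum_prod_type]

theorem mem_repetition {ι : Type*} {C : BinaryCode ι} {m : ℕ} {x : Fin m × ι → ZMod 2} :
    x ∈ repetition m C ↔ ∃ y ∈ C, y ∘ Prod.snd = x := Iff.rfl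

theorem comp_snd_ne_zero {ι : Type*} {m : ℕ} (hm : 0 < m) {x : ι → ZMod 2} (hx : x ≠ 0) :
    x ∘ (Prod.snd : Fin m × ι → ι) ≠ 0 := fun h =>
  hx (funext fun i => congrFun h (⟨0, hm⟩, i))

theorem ConnectedBy.repetition (h : C.ConnectedBy G w) {m : ℕ} (hm : 0 < m) :
    (repetition m C).ConnectedBy ((fun x => x ∘ Prod.snd) '' G) (m * w) where
  span_eq := by
    rw [BinaryCode.repetition, ← h.span_eq, Submodule.map_span]
    rfl
  norm_eq := by
    rintro _ ⟨g, hg, rfl⟩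
    rw [hammingNorm_comp_snd, h.norm_eq g hg]
  divisible := by
    intro x hx
    obtain ⟨y, hy, rfl⟩ := mem_repetition.1 hx
    rw [hammingNorm_comp_snd]
    exact Nat.mul_dvd_mul_left m (h.divisible y hy)
  exists_meet := by
    rintro _ ⟨x, hx, rfl⟩ _ ⟨y, hy, rfl⟩ hxy
    obtain ⟨r, hr, hrx, hry⟩ := h.exists_meet x hx y hy (by
      by_contra h0
      exact comp_snd_ne_zero hm h0 hxy)
    exact ⟨_, ⟨r, hr, rfl⟩, comp_snd_ne_zero hm hrx, comp_snd_ne_zero hm hry⟩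

theorem finrank_repetition {ι : Type*} {C : BinaryCode ι} {m : ℕ} (hm : 0 < m) :
    Module.finrank (ZMod 2) (repetition m C) = Module.finrank (ZMod 2) C :=
  (LinearEquiv.finrank_eq (Submodule.equivMapOfInjective _
    (LinearMap.funLeft_injective_of_surjective _ _ _ fun i => ⟨(⟨0, hm⟩, i), rfl⟩) C)).symm

theorem ConnectedBy.inClass_repetition (h : C.ConnectedBy G w) (hfull : C.FullLength)
    (hdim : 1 ≤ Module.finrank (ZMod 2) C) {m : ℕ} (hm : 0 < m) :
    (BinaryCode.repetition m C).InClass (m * w) ∧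
      Module.finrank (ZMod 2) (BinaryCode.repetition m C) = Module.finrank (ZMod 2) C := by
  refine ⟨(h.repetition hm).inClass ?_ ?_, finrank_repetition hm⟩
  · rintro ⟨p, i⟩
    obtain ⟨c, hc, hci⟩ := hfull i
    exact ⟨_, ⟨c, hc, rfl⟩, hci⟩
  · rwa [finrank_repetition hm]

end Connected

section Standard

/-- A binary function on `𝔽₂^ρ` that changes its value under some translation takes the value `1`
on exactly half of the vectors. -/
theorem two_mul_sum_val {ρ : Type*} [Fintype ρ] [DecidableEq ρ] (g : (ρ → ZMod 2) → ZMod 2)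
    (w : ρ → ZMod 2) (h : ∀ v, g (v + w) = g v + 1) :
    2 * ∑ v, (g v).val = 2 ^ Fintype.card ρ := by
  have h1 := Equiv.sum_comp (Equiv.addRight w) fun v => (g v).val
  have h2 : ∀ z : ZMod 2, z.val + (z + 1).val = 1 := by decide
  simp only [Equiv.coe_addRight, h] at h1
  have h3 : ∑ v, ((g v).val + (g v + 1).val) = 2 ^ Fintype.card ρ := by simp [h2, ZMod.card]
  rw [Finset.sum_add_distrib] at h3
  omega

theorem mem_simplex {k : ℕ} {x : {v : Fin k → ZMod 2 // v ≠ 0} → ZMod 2} :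
    x ∈ simplex k ↔ ∃ a : Fin k → ZMod 2, x = fun v => v.1 ⬝ᵥ a := by
  rw [simplex, ofGenerator, Submodule.mem_span_range_iff_exists_fun]
  refine exists_congr fun a => ?_
  have : ∑ i, a i • (Matrix.of fun (r : Fin k) (v : {v : Fin k → ZMod 2 // v ≠ 0}) => v.1 r) i =
      fun v => v.1 ⬝ᵥ a := by
    funext v
    simp [dotProduct, Finset.sum_apply, mul_comm]
  rw [this, eq_comm]

theorem simplex_oneWeight {k : ℕ} (hk : 1 ≤ k) : (simplex k).OneWeight (2 ^ (k - 1)) := by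
  intro x hx hx0
  obtain ⟨a, rfl⟩ := mem_simplex.1 hx
  have ha : a ≠ 0 := by
    rintro rfl
    exact hx0 (funext fun v => dotProduct_zero _)
  obtain ⟨w, hw⟩ := exists_dotProduct_eq_one ha
  have h := two_mul_sum_val (fun v => v ⬝ᵥ a) w fun v => by rw [add_dotProduct, hw]
  have h1 : ∑ v : Fin k → ZMod 2, (v ⬝ᵥ a).val =
      ∑ v : {v : Fin k → ZMod 2 // v ≠ 0}, (v.1 ⬝ᵥ a).val := by
    rw [← Fintype.sum_subtype_add_sum_subtype (fun v : Fin k → ZMod 2 => v ≠ 0), add_eq_left]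
    refine Finset.sum_eq_zero fun v _ => ?_
    rw [not_not.1 v.2, zero_dotProduct, ZMod.val_zero]
  obtain ⟨l, rfl⟩ : ∃ l, k = l + 1 := ⟨k - 1, by omega⟩
  rw [h1, Fintype.card_fin, pow_succ] at h
  rw [hammingNorm_eq_sum_val, Nat.add_sub_cancel]
  omega

theorem simplex_fullLength (k : ℕ) : (simplex k).FullLength := by
  rintro ⟨v, hv⟩
  obtain ⟨r, hr⟩ := Function.ne_iff.1 hv
  exact ⟨_, Submodule.subset_span ⟨r, rfl⟩, hr⟩

theorem finrank_simplex (k : ℕ) : Module.finrank (ZMod 2) (simplex k) = k := by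
  rw [simplex, ofGenerator, finrank_span_eq_card, Fintype.card_fin]
  rw [Fintype.linearIndependent_iff]
  intro a ha r
  have := congrFun ha ⟨Pi.single r 1, by simp⟩
  simpa [Finset.sum_apply, Pi.single_apply] using this

theorem sum_smul_reedMuller_apply {l : ℕ} (a : Fin l ⊕ Unit → ZMod 2) (v : Fin l → ZMod 2) :
    (∑ r, a r • (Matrix.of fun (r : Fin l ⊕ Unit) (v : Fin l → ZMod 2) =>
      Sum.elim v (fun _ => 1) r) r) v = (v ⬝ᵥ fun r => a (Sum.inl r)) + a (Sum.inr ()) := by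
  rw [Finset.sum_apply, Fintype.sum_sum_type]
  simp [dotProduct, mul_comm]

theorem exists_eq_of_mem_reedMuller {k : ℕ} {x : (Fin (k - 1) → ZMod 2) → ZMod 2}
    (hx : x ∈ reedMuller k) : ∃ (a : Fin (k - 1) → ZMod 2) (c : ZMod 2), x = fun v => v ⬝ᵥ a + c := by
  obtain ⟨a, rfl⟩ := Submodule.mem_span_range_iff_exists_fun (ZMod 2) |>.1 hx
  exact ⟨_, _, funext (sum_smul_reedMuller_apply a)⟩

theorem one_mem_reedMuller (k : ℕ) : 1 ∈ reedMuller k :=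
  Submodule.subset_span ⟨Sum.inr (), rfl⟩

theorem reedMuller_weights {k : ℕ} (hk : 2 ≤ k) :
    (reedMuller k).ReedMullerWeights (2 ^ (k - 2)) 1 := by
  obtain ⟨l, rfl⟩ : ∃ l, k = l + 2 := ⟨k - 2, by omega⟩
  refine ⟨one_mem_reedMuller _, ?_, ?_⟩
  · rw [hammingNorm_eq_sum_val]
    simp [ZMod.val_one, ZMod.card, pow_succ, mul_comm]
  · intro x hx hx0 hx1
    obtain ⟨a, c, rfl⟩ := exists_eq_of_mem_reedMuller hx
    by_cases ha : a = 0
    · have two : ∀ z : ZMod 2, z = 0 ∨ z = 1 := by decide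
      simp only [ha, dotProduct_zero, zero_add] at hx0 hx1
      rcases two c with rfl | rfl
      · exact absurd rfl hx0
      · exact absurd rfl hx1
    · obtain ⟨w, hw⟩ := exists_dotProduct_eq_one ha
      have h := two_mul_sum_val (fun v => v ⬝ᵥ a + c) w fun v => by
        rw [add_dotProduct, hw, add_right_comm]
      rw [Fintype.card_fin] at h
      rw [hammingNorm_eq_sum_val]
      have e : 2 ^ (l + 2 - 1) = 2 * 2 ^ (l + 2 - 2) := by
        rw [Nat.add_sub_cancel, ← pow_succ']
        rfl
      rw [e] at h
      exact Nat.eq_of_mul_eq_mul_left two_pos h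

theorem reedMuller_fullLength (k : ℕ) : (reedMuller k).FullLength := fun _ =>
  ⟨1, one_mem_reedMuller k, one_ne_zero⟩

theorem finrank_reedMuller {k : ℕ} (hk : 1 ≤ k) :
    Module.finrank (ZMod 2) (reedMuller k) = k := by
  rw [reedMuller, ofGenerator, finrank_span_eq_card, Fintype.card_sum, Fintype.card_fin,
    Fintype.card_unit, Nat.sub_add_cancel hk]
  rw [Fintype.linearIndependent_iff]
  intro a ha
  have hval := sum_smul_reedMuller_apply a
  have h0 : a (Sum.inr ()) = 0 := by
    have h := hval 0
    rw [zero_dotProduct, zero_add] at h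
    exact h.symm.trans (congrFun ha 0)
  rintro (r | r)
  · have h := hval (Pi.single r 1)
    rw [h0, add_zero, single_one_dotProduct] at h
    exact h.symm.trans (congrFun ha _)
  · exact h0

theorem parityCheck_connectedBy (k : ℕ) : (parityCheck k).ConnectedBy
    {x | ∃ i j, i ≠ j ∧ x = Pi.single i 1 + Pi.single j 1} 2 where
  span_eq := by
    apply le_antisymm
    · rw [Submodule.span_le]
      rintro _ ⟨i, j, -, rfl⟩
      change ∑ l, (Pi.single i 1 + Pi.single j 1 : Fin (k + 1) → ZMod 2) l = 0
      simp [Finset.sum_add_distrib, CharTwo.add_self_eq_zero]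
    · rw [parityCheck_eq_ofGenerator, ofGenerator, Submodule.span_le]
      rintro _ ⟨i, rfl⟩
      by_cases hi : i = 0
      · subst hi
        change (Pi.single 0 1 + Pi.single 0 1 : Fin (k + 1) → ZMod 2) ∈ _
        rw [word_add_self]
        exact Submodule.zero_mem _
      · exact Submodule.subset_span ⟨i, 0, hi, rfl⟩
  norm_eq := by
    rintro _ ⟨i, j, hij, rfl⟩
    have h1 : ∀ i : Fin (k + 1), hammingNorm (Pi.single i 1 : Fin (k + 1) → ZMod 2) = 1 := by
      intro i
      simp [hammingNorm, Pi.single_apply, Finset.filter_eq']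
    rw [hammingNorm_add_of_mul_eq_zero, h1, h1]
    funext l
    by_cases hl : l = i
    · subst hl
      simp [Pi.single_eq_of_ne hij]
    · simp [Pi.single_eq_of_ne hl]
  divisible := by
    intro x hx
    have hx : ∑ i, x i = 0 := hx
    rw [hammingNorm_eq_sum_val, ← ZMod.natCast_eq_zero_iff]
    simpa using hx
  exists_meet := by
    rintro _ ⟨i, j, hij, rfl⟩ _ ⟨i', j', hij', rfl⟩ h
    have hii' : i ≠ i' := by
      rintro rfl
      simpa [hij, hij', Pi.single_eq_of_ne] using congrFun h i
    refine ⟨_, ⟨i, i', hii', rfl⟩, fun h0 => ?_, fun h0 => ?_⟩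
    · simpa [hij, hii', Pi.single_eq_of_ne] using congrFun h0 i
    · simpa [hij', hii'.symm, Pi.single_eq_of_ne] using congrFun h0 i'

theorem parityCheck_fullLength {k : ℕ} (hk : 1 ≤ k) : (parityCheck k).FullLength := by
  intro i
  have : Nontrivial (Fin (k + 1)) := Fin.nontrivial_iff_two_le.2 (by omega)
  obtain ⟨j, hji⟩ := exists_ne i
  refine ⟨Pi.single i 1 + Pi.single j 1, ?_, by simp [Pi.single_eq_of_ne hji.symm]⟩
  rw [← (parityCheck_connectedBy k).span_eq]
  exact Submodule.subset_span ⟨i, j, hji.symm, rfl⟩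

theorem finrank_parityCheck (k : ℕ) : Module.finrank (ZMod 2) (parityCheck k) = k := by
  set f : (Fin (k + 1) → ZMod 2) →ₗ[ZMod 2] ZMod 2 := ∑ i, LinearMap.proj i with hf
  have hker : parityCheck k = LinearMap.ker f := by
    ext x
    rw [LinearMap.mem_ker]
    simp only [hf, LinearMap.sum_apply, LinearMap.proj_apply]
    rfl
  have hsurj : Function.Surjective f := fun z => ⟨Pi.single 0 z, by simp [hf]⟩
  have h := f.finrank_range_add_finrank_ker
  rw [LinearMap.range_eq_top.2 hsurj, finrank_top, Module.finrank_self, Module.finrank_fin_fun]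
    at h
  rw [hker]
  omega

end Standard

/-! ### The classification list -/

section Entries

theorem Iso.finrank_eq {ι κ : Type*} {C : BinaryCode ι} {D : BinaryCode κ} (h : Iso C D) :
    Module.finrank (ZMod 2) C = Module.finrank (ZMod 2) D := by
  obtain ⟨e, rfl⟩ := h
  exact LinearEquiv.finrank_eq (Submodule.equivMapOfInjective _
    (LinearMap.funLeft_injective_of_surjective _ _ _ e.symm.surjective) C)

theorem Iso.card_eq {ι κ : Type*} {C : BinaryCode ι} {D : BinaryCode κ} [Fintype ι] [Fintype κ]
    (h : Iso C D) : Fintype.card ι = Fintype.card κ :=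
  Fintype.card_congr h.choose

namespace Entry

variable {Δ a : ℕ}

theorem two_pow_dvd_of_le (ha : 2 ^ a ∣ Δ) {j : ℕ} (hj : j ≤ a) : 2 ^ j ∣ Δ :=
  (pow_dvd_pow 2 hj).trans ha

theorem code_inClass (hΔ : 0 < Δ) (ha : 2 ^ a ∣ Δ) (e : Entry) (he : e.Listed a) :
    (e.code Δ).InClass Δ ∧ Module.finrank (ZMod 2) (e.code Δ) = e.dim := by
  rcases e with k | k | k
  · obtain ⟨hk1, hk⟩ := he
    have hdvd : 2 ^ (k - 1) ∣ Δ := two_pow_dvd_of_le ha (by omega)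
    have h := (simplex_oneWeight hk1).connectedBy.inClass_repetition (simplex_fullLength k)
      (by rwa [finrank_simplex]) (Nat.div_pos (Nat.le_of_dvd hΔ hdvd) (by positivity))
    rw [Nat.div_mul_cancel hdvd, finrank_simplex] at h
    exact h
  · obtain ⟨hk3, hk⟩ := he
    have hdvd : 2 ^ (k - 2) ∣ Δ := two_pow_dvd_of_le ha (by omega)
    have hfin := finrank_reedMuller (k := k) (by omega)
    have h := ((reedMuller_weights (k := k) (by omega)).connectedBy (by positivity)
      (by rwa [hfin])).inClass_repetition (reedMuller_fullLength k)
      (by omega) (Nat.div_pos (Nat.le_of_dvd hΔ hdvd) (by positivity))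
    rw [Nat.div_mul_cancel hdvd, hfin] at h
    exact h
  · obtain ⟨ha1, hk⟩ := he
    have hdvd : 2 ∣ Δ := by simpa using two_pow_dvd_of_le ha ha1
    have h := (parityCheck_connectedBy k).inClass_repetition (parityCheck_fullLength (by omega))
      (by rw [finrank_parityCheck]; omega) (Nat.div_pos (Nat.le_of_dvd hΔ hdvd) (by positivity))
    rw [Nat.div_mul_cancel hdvd, finrank_parityCheck] at h
    exact h

theorem card_pos_sim_lt (hΔ : 0 < Δ) (ha : 2 ^ a ∣ Δ) {k : ℕ} (hk : (sim k).Listed a) :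
    Fintype.card ((sim k).Pos Δ) < 2 * Δ := by
  obtain ⟨hk1, hk⟩ := hk
  obtain ⟨l, rfl⟩ : ∃ l, k = l + 1 := ⟨k - 1, by omega⟩
  obtain ⟨m, rfl⟩ := two_pow_dvd_of_le ha (show l ≤ a by omega)
  have hcard : Fintype.card {v : Fin (l + 1) → ZMod 2 // v ≠ 0} < 2 ^ (l + 1) := by
    have := Fintype.card_subtype_lt (p := fun v : Fin (l + 1) → ZMod 2 => v ≠ 0) (x := 0) (by simp)
    rwa [Fintype.card_fun, ZMod.card, Fintype.card_fin] at this
  change Fintype.card (Fin (2 ^ l * m / 2 ^ l) × {v : Fin (l + 1) → ZMod 2 // v ≠ 0}) < _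
  rw [Fintype.card_prod, Fintype.card_fin, Nat.mul_div_cancel_left _ (by positivity)]
  have hm : 0 < m := Nat.pos_of_mul_pos_left hΔ
  calc m * _ < m * 2 ^ (l + 1) := Nat.mul_lt_mul_of_pos_left hcard hm
    _ = 2 * (2 ^ l * m) := by ring

theorem card_pos_rm (ha : 2 ^ a ∣ Δ) {k : ℕ} (hk : (rm k).Listed a) :
    Fintype.card ((rm k).Pos Δ) = 2 * Δ := by
  obtain ⟨hk1, hk⟩ := hk
  obtain ⟨l, rfl⟩ : ∃ l, k = l + 2 := ⟨k - 2, by omega⟩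
  obtain ⟨m, rfl⟩ := two_pow_dvd_of_le ha (show l ≤ a by omega)
  change Fintype.card (Fin (2 ^ l * m / 2 ^ l) × (Fin (l + 1) → ZMod 2)) = _
  rw [Fintype.card_prod, Fintype.card_fin, Nat.mul_div_cancel_left _ (by positivity)]
  simp only [Fintype.card_pi, ZMod.card, Finset.prod_const, Finset.card_univ, Fintype.card_fin]
  ring

theorem lt_card_pos_pc (hΔ : 0 < Δ) (ha : 2 ^ a ∣ Δ) {k : ℕ} (hk : (pc k).Listed a) :
    2 * Δ < Fintype.card ((pc k).Pos Δ) := by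
  obtain ⟨ha1, hk⟩ := hk
  obtain ⟨m, rfl⟩ : 2 ∣ Δ := by simpa using two_pow_dvd_of_le ha ha1
  change _ < Fintype.card (Fin (2 * m / 2) × Fin (k + 1))
  rw [Fintype.card_prod, Fintype.card_fin, Fintype.card_fin, Nat.mul_div_cancel_left _ two_pos]
  have : m * 5 ≤ m * (k + 1) := Nat.mul_le_mul_left _ (by omega)
  omega

/-- Dimension and length separate the listed codes: the length is less than, equal to, or greater
than `2 * Δ` in the three families. -/
theorem eq_of_iso (hΔ : 0 < Δ) (ha : 2 ^ a ∣ Δ) {e e' : Entry} (he : e.Listed a)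
    (he' : e'.Listed a) (h : Iso (e.code Δ) (e'.code Δ)) : e = e' := by
  have hdim := h.finrank_eq
  rw [(code_inClass hΔ ha e he).2, (code_inClass hΔ ha e' he').2] at hdim
  have hcard := h.card_eq
  rcases e with k | k | k <;> rcases e' with k' | k' | k' <;> simp only [dim] at hdim <;>
    subst hdim
  · rfl
  · have := card_pos_sim_lt hΔ ha he
    have := card_pos_rm ha he'
    omega
  · have := card_pos_sim_lt hΔ ha he
    have := lt_card_pos_pc hΔ ha he'
    omega
  · have := card_pos_rm ha he
    have := card_pos_sim_lt hΔ ha he'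
    omega
  · rfl
  · have := card_pos_rm ha he
    have := lt_card_pos_pc hΔ ha he'
    omega
  · have := lt_card_pos_pc hΔ ha he
    have := card_pos_sim_lt hΔ ha he'
    omega
  · have := lt_card_pos_pc hΔ ha he
    have := card_pos_rm ha he'
    omega
  · rfl

end Entry

theorem InClass.exists_iso {ι : Type*} [Fintype ι] {Δ a : ℕ} (hΔ : 0 < Δ)
    (ha : ∀ b, 2 ^ b ∣ Δ → b ≤ a) {C : BinaryCode ι} (hC : C.InClass Δ) :
    ∃ e : Entry, e.Listed a ∧ e.dim = Module.finrank (ZMod 2) C ∧ Iso C (e.code Δ) := by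
  have hdim := hC.one_le_dim
  rcases hC.hasType hΔ with h | ⟨h3, u, h⟩ | ⟨k, hk, e, he, rfl⟩
  · obtain ⟨hdvd, hiso⟩ := h.iso_simplex hC.fullLength rfl hdim
    have := ha _ hdvd
    exact ⟨.sim _, ⟨hdim, by omega⟩, rfl, hiso⟩
  · obtain ⟨hdvd, hiso⟩ := h.iso_reedMuller hΔ hC.fullLength rfl (by omega)
    have := ha _ hdvd
    exact ⟨.rm _, ⟨h3, by omega⟩, rfl, hiso⟩
  · obtain ⟨hdvd, hiso⟩ := he.iso_parityCheck hC.fullLength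
    refine ⟨.pc k, ⟨ha 1 (by simpa using hdvd), hk⟩, ?_, hiso⟩
    rw [hiso.finrank_eq, finrank_repetition (Nat.div_pos (Nat.le_of_dvd hΔ hdvd) two_pos),
      finrank_parityCheck]
    rfl

end Entries

end BinaryCode

theorem mainTheorem2 (Δ a : ℕ) (hΔ : 0 < Δ) (ha : IsGreatest {b : ℕ | 2 ^ b ∣ Δ} a) :
    -- all listed codes belong to the class, and have the stated dimension
    (∀ e : BinaryCode.Entry, e.Listed a →
      BinaryCode.InClass (e.code Δ) Δ ∧ Module.finrank (ZMod 2) (e.code Δ) = e.dim) ∧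
    -- the list is complete
    (∀ (n : ℕ) (C : BinaryCode (Fin n)), BinaryCode.InClass C Δ →
      ∃ e : BinaryCode.Entry, e.Listed a ∧ e.dim = Module.finrank (ZMod 2) C ∧
        BinaryCode.Iso C (e.code Δ)) ∧
    -- the list is non-redundant
    (∀ e e' : BinaryCode.Entry, e.Listed a → e'.Listed a →
      BinaryCode.Iso (e.code Δ) (e'.code Δ) → e = e') :=
  ⟨fun e he => BinaryCode.Entry.code_inClass hΔ ha.1 e he,
    fun _ _ hC => hC.exists_iso hΔ fun _ hb => ha.2 hb,
    fun _ _ he he' h => BinaryCode.Entry.eq_of_iso hΔ ha.1 he he' h⟩
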